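/- Let $X$ be an infinite set and let $\mathrm{Sym}(X)$ be the group of permutations of $X$ with finite support. Let $H$ be a finite group with $M$ conjugacy classes, let $H^{(X)}$ be the group of finitely supported functions $X\to H$, and let $W=H\wr_X\mathrm{Sym}(X)=H^{(X)}\rtimes\mathrm{Sym}(X)$ be the permutational wreath product, with multiplication $(\varphi,f)(\psi,g)=(\varphi\cdot(\psi\circ f^{-1}),fg)$. For $u\in X$ and $a\in H\setminus\{1\}$ let $\varphi_u^a\in H^{(X)}$ be the function with value $a$ at $u$ and $1$ elsewhere. Let $S=S_H\sqcup S_X\subseteq W$, where $S_H$ is a set of elements of the form $\varphi_u^a$ and $S_X$ is a set of transpositions of $X$, and let $\Gamma(S_X)$ be the graph with vertex set $X$ in which $x\neq y$ are adjacent if and only if $(x\ y)\in S_X$. Assume that $S$ is sufficiently large in the following sense: $\Gamma(S_X)$ is connected, and for every partition $\lambda=(\lambda_1,\dots,\lambda_k)$ of every integer $L\ge 0$ the graph $\Gamma(S_X)$ contains a forest of $k$ pairwise disjoint trees $T_1,\dots,T_k$ such that $T_i$ has $\lambda_i$ vertices, including a vertex $x^{(i)}$ with $\varphi_{x^{(i)}}^a\in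 S_H$ for all $a\in H\setminus\{1\}$. Then $S$ generates $W$. For $w\in W$ let $\kappa(w)$ be the smallest word length, with respect to $S\cup S^{-1}$, of an element of the conjugacy class of $w$, and for $n\ge 0$ let $\gamma(n)$ be the number of conjugacy classes on which $\kappa=n$. Every $\gamma(n)$ is finite, and as formal power series $$\sum_{[w]\in\mathrm{Conj}(W)}q^{\kappa(w)}=\sum_{n=0}^{\infty}\gamma(n)q^n=\prod_{n=1}^{\infty}(1-q^n)^{-M}.$$ Moreover, for every $n\ge1$, $$\gamma(n)=\widehat F_n\big(\gamma(1),\dots,\gamma(n-1)\big)+\frac{M}{n}\,\sigma_1(n),$$ where $\sigma_1(n)=\sum_{d\mid n}d$ and $\widehat F_n$ is the polynomial, depending only on $n$, $$\widehat F_n(x_1,\dots,x_{n-1})=\sum_{\substack{m_1,\dots,m_{n-1}\ge0\\ m_1+2m_2+\cdots+(n-1)m_{n-1}=n}}(-1)^{m_1+\cdots+m_{n-1}}\,\frac{(m_1+\cdots+m_{n-1}-1)!}{m_1!\cdots m_{n-1}!}\,x_1^{m_1}\cdots x_{n-1}^{m_{n-1}}$$ (so $\widehat F_1=0$, an empty sum).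 -/

import Mathlib

open scoped PowerSeries.WithPiTopology

noncomputable section

namespace WreathGrowth

/-! ### Conjugacy growth of a group with respect to a set -/

section Growth

variable {G : Type*} [Group G]

/-- The word length of `g`: the least `n` such that `g = s₁ ⋯ sₙ` with all `sᵢ ∈ S ∪ S⁻¹`
(meaningful when `S` generates `G`). -/
def wordLength (S : Set G) (g : G) : ℕ :=
  sInf {n : ℕ | ∃ l : List G, l.length = n ∧ (∀ s ∈ l, s ∈ S ∨ s⁻¹ ∈ S) ∧ l.prod = g}

/-- The conjugacy length of a conjugacy class: the least word length of its elements. -/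
def conjLength (S : Set G) (c : ConjClasses G) : ℕ :=
  sInf (wordLength S '' c.carrier)

/-- The number, possibly infinite, of conjugacy classes of conjugacy length `n`. -/
def conjGrowth (S : Set G) (n : ℕ) : ℕ∞ :=
  Set.encard {c : ConjClasses G | conjLength S c = n}

/-- The conjugacy growth series `∑ γ(n) qⁿ`, as a formal power series
(meaningful when all `γ(n)` are finite). -/
def conjGrowthSeries (S : Set G) : PowerSeries ℚ :=
  PowerSeries.mk fun n => ((conjGrowth S n).toNat : ℚ)

end Growth

/-! ### The permutational wreath product -/

/-- The finitary symmetric group: permutations of `X` that move only finitely many points. -/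
def FinitarySym (X : Type*) : Subgroup (Equiv.Perm X) where
  carrier := {f | {x | f x ≠ x}.Finite}
  one_mem' := by simp
  mul_mem' := by
    intro f g hf hg
    refine (Set.Finite.union hf hg).subset fun x hx => ?_
    by_contra h
    simp only [Set.mem_union, Set.mem_ofPred_eq, not_or, not_not] at h
    exact hx (by rw [Equiv.Perm.mul_apply, h.2, h.1])
  inv_mem' := by
    intro f hf
    refine Set.Finite.subset hf fun x hx h => hx ?_
    rw [Equiv.Perm.inv_eq_iff_eq, h]

/-- The group `H^(X)` of functions `X → H` with finite support, under pointwise multiplication. -/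
def FinSuppFun (H X : Type*) [Group H] : Subgroup (X → H) where
  carrier := {φ | (Function.mulSupport φ).Finite}
  one_mem' := by simp
  mul_mem' := by
    intro φ ψ hφ hψ
    exact (Set.Finite.union hφ hψ).subset (Function.mulSupport_mul φ ψ)
  inv_mem' := by
    intro φ hφ
    simpa [Function.mulSupport_inv] using hφ

/-- The action of the finitary symmetric group on `H^(X)`: `f` sends `ψ` to `ψ ∘ f⁻¹`. -/
def permAction (H X : Type*) [Group H] : FinitarySym X →* MulAut (FinSuppFun H X) where
  toFun f :=
    { toFun := fun ψ => ⟨ψ.1 ∘ (f.1⁻¹ : Equiv.Perm X),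
        Set.Finite.preimage (f.1⁻¹ : Equiv.Perm X).injective.injOn ψ.2⟩
      invFun := fun ψ => ⟨ψ.1 ∘ f.1, Set.Finite.preimage f.1.injective.injOn ψ.2⟩
      left_inv := fun ψ => by ext x; simp
      right_inv := fun ψ => by ext x; simp
      map_mul' := fun ψ χ => rfl }
  map_one' := by ext ψ x; rfl
  map_mul' f g := by ext ψ x; simp

/-- The permutational wreath product `H ≀_X Sym(X) = H^(X) ⋊ Sym(X)`, with multiplication
`(φ, f) (ψ, g) = (φ · f(ψ), f g)`. -/
abbrev Wreath (H X : Type*) [Group H] : Type _ :=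
  FinSuppFun H X ⋊[permAction H X] FinitarySym X

/-! ### Partition-complete generating sets of the wreath product -/

open Classical in
/-- The function with value `a` at `u` and `1` elsewhere. In the wreath product it acts on `H × X`
by `(h, u) ↦ (a h, u)`, fixing all `(h, x)` with `x ≠ u`. -/
def single {H X : Type*} [Group H] (u : X) (a : H) : FinSuppFun H X :=
  ⟨Pi.mulSingle u a, (Set.finite_singleton u).subset Pi.mulSupport_mulSingle_subset⟩

open Classical in
/-- The transposition `(x y)`. -/
def transposition {X : Type*} (x y : X) : FinitarySym X :=
  ⟨Equiv.swap x y, by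
    refine (Set.toFinite {x, y}).subset fun z hz => ?_
    by_contra h
    simp only [Set.mem_insert_iff, Set.mem_singleton_iff, not_or] at h
    exact hz (Equiv.swap_apply_of_ne_of_ne h.1 h.2)⟩

/-- The set of all functions supported at a single point. -/
def TH (H X : Type*) [Group H] : Set (FinSuppFun H X) :=
  {φ | ∃ (u : X) (a : H), a ≠ 1 ∧ φ = single u a}

/-- The set of all transpositions. -/
def TX (X : Type*) : Set (FinitarySym X) :=
  {f | ∃ x y : X, x ≠ y ∧ f = transposition x y}

/-- The transposition graph of a set of transpositions: its vertex set is `X`, and distinct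
`x`, `y` are adjacent when `(x y)` is in the set. -/
def transpositionGraph {X : Type*} (SX : Set (FinitarySym X)) : SimpleGraph X :=
  SimpleGraph.fromRel fun x y => transposition x y ∈ SX

/-- Partition-complete subsets `S = S_H ⊔ S_X` of the wreath product (property PCwr).
A partition is given by its positive parts `l 0, …, l (k - 1)`; the order of the parts, and
hence of the trees, is immaterial. The trees are subgraphs, not necessarily induced, and form a
forest: they are pairwise disjoint. -/
def IsPCwr {H X : Type*} [Group H] (S : Set (Wreath H X)) : Prop :=
  ∃ (SH : Set (FinSuppFun H X)) (SX : Set (FinitarySym X)),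
    SH ⊆ TH H X ∧ SX ⊆ TX X ∧
    S = SemidirectProduct.inl '' SH ∪ SemidirectProduct.inr '' SX ∧
    (transpositionGraph SX).Connected ∧
    ∀ (k : ℕ) (l : Fin k → ℕ), (∀ i, 0 < l i) →
      ∃ T : Fin k → (transpositionGraph SX).Subgraph,
        (∀ i, (T i).coe.IsTree) ∧
        (∀ i j, i ≠ j → Disjoint (T i).verts (T j).verts) ∧
        (∀ i, (T i).verts.encard = l i) ∧
        ∀ i, ∃ x ∈ (T i).verts, ∀ a : H, a ≠ 1 → single x a ∈ SH

/-! ### The universal polynomials -/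

/-- The tuples `(m_1, …, m_{n-1})` of natural numbers with `m_1 + 2 m_2 + ⋯ + (n-1) m_{n-1} = n`;
the coordinate `m i` is `m_{i+1}`. Every entry of such a tuple is at most `n`. -/
def exponents (n : ℕ) : Finset (Fin (n - 1) → ℕ) :=
  (Fintype.piFinset fun _ => Finset.range (n + 1)).filter
    fun m => ∑ i : Fin (n - 1), ((i : ℕ) + 1) * m i = n

/-- The polynomial `F̂_n` in `x_1, …, x_{n-1}`; the variable `MvPolynomial.X i` is `x_{i+1}`. -/
def Fhat (n : ℕ) : MvPolynomial (Fin (n - 1)) ℚ :=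
  ∑ m ∈ exponents n,
    MvPolynomial.C ((-1 : ℚ) ^ (∑ i, m i) * ((∑ i, m i) - 1).factorial
        / ∏ i, ((m i).factorial : ℚ)) *
      ∏ i, MvPolynomial.X i ^ m i

end WreathGrowth

end

/-! An element `w` of the wreath product acts on `H × X`; over each cycle of its permutation the
values multiply to a cycle product, defined up to conjugacy in `H`. A cycle therefore has a type
(length, class of the cycle product), and the finite multiset of types different from (1, class of
1) is a complete conjugacy invariant: `typeMultiset_conj` and `isConj_of_typeMultiset_eq`.

The conjugacy length is the sum over these cycles of a weight: the length minus one if the cycle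
product is trivial, the length otherwise (`conjLength_mk`). The lower bound is linear algebra in the
free rational vector space on `X`. Each letter is charged one vector, `e_u` for a one-point function
and `e_y - e_z` for a transposition. The span of the vectors of a word, enlarged by one basis vector
for each nontrivial cycle with trivial product, contains `e_x` for all points `x` of nontrivial
cycles, so dimensions can be compared (`sum_typeWeight_le_length`). The upper bound uses the forest:
inside a tree on `l` vertices, `l - 1` edge transpositions multiply to an `l`-cycle, and one more
letter at the marked vertex gives any nontrivial cycle product (`exists_typeMultiset_eq`).

For every `n ≥ 1` and every class `c` of `H` there is exactly one nontrivial type of weight `n` with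
class `c`, of length `n + 1` if `c` is the class of 1 and `n` otherwise. Conjugacy classes of the
wreath product are thus multisets of pairs (weight, class), which yields the Euler product. The
recursion compares two computations of the coefficients of the logarithm of this product: expanding
the logarithm by the multinomial theorem gives `Fhat`, and the logarithmic derivative is a Lambert
series giving `σ₁`. -/

noncomputable section

namespace WreathGrowth

/-! ### Cycle types and their invariance under conjugation -/

section Action

variable {H X : Type*} [Group H]

/-- The permutation of `X` underlying an element of the wreath product. -/
def perm (w : Wreath H X) : Equiv.Perm X := w.right.1

/-- The cocycle of the action on `H × X`, where `w` sends `(h, x)` to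
`(cocycle w x * h, perm w x)`. -/
def cocycle (w : Wreath H X) (x : X) : H := w.left.1 (w.right.1 x)

@[simp] theorem perm_one : perm (1 : Wreath H X) = 1 := rfl

@[simp] theorem cocycle_one (x : X) : cocycle (1 : Wreath H X) x = 1 := rfl

@[simp] theorem perm_mul (w v : Wreath H X) : perm (w * v) = perm w * perm v := rfl

@[simp] theorem cocycle_mul (w v : Wreath H X) (x : X) :
    cocycle (w * v) x = cocycle w (perm v x) * cocycle v x := by
  simp [cocycle, perm, permAction]

@[simp] theorem perm_inv (w : Wreath H X) : perm w⁻¹ = (perm w)⁻¹ := rfl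

@[simp] theorem perm_pow (w : Wreath H X) (n : ℕ) : perm (w ^ n) = perm w ^ n := by
  induction n with
  | zero => rfl
  | succ n ih => rw [pow_succ, pow_succ, perm_mul, ih]

theorem cocycle_inv (w : Wreath H X) (x : X) :
    cocycle w⁻¹ (perm w x) = (cocycle w x)⁻¹ := by
  rw [eq_inv_iff_mul_eq_one, ← cocycle_mul, inv_mul_cancel, cocycle_one]

theorem ext_action {w v : Wreath H X} (hp : ∀ x, perm w x = perm v x)
    (hc : ∀ x, cocycle w x = cocycle v x) : w = v := by
  have hr : w.right = v.right := Subtype.ext (Equiv.ext hp)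
  refine SemidirectProduct.ext (Subtype.ext (funext fun x => ?_)) hr
  have := hc ((perm w).symm x)
  rw [cocycle, cocycle, ← hr] at this
  simpa [perm] using this

theorem finite_perm_ne (w : Wreath H X) : {x | perm w x ≠ x}.Finite := w.right.2

theorem finite_cocycle_ne (w : Wreath H X) : {x | cocycle w x ≠ 1}.Finite :=
  w.left.2.preimage (f := perm w) (perm w).injective.injOn

/-- The length of the cycle through `x`. -/
def period (w : Wreath H X) (x : X) : ℕ := Function.minimalPeriod (perm w) x

theorem perm_pow_apply (w : Wreath H X) (n : ℕ) (x : X) :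
    perm (w ^ n) x = (perm w)^[n] x := by
  rw [perm_pow, ← Equiv.Perm.iterate_eq_pow]

/-- `Function.minimalPeriod` is 0 at non-periodic points, so this excludes infinite cycles: the
orbit of a non-fixed point stays in the finite set of non-fixed points, and the pigeonhole principle
applies. -/
theorem period_pos (w : Wreath H X) (x : X) : 0 < period w x := by
  apply Function.minimalPeriod_pos_of_mem_periodicPts
  by_cases hx : perm w x = x
  · exact ⟨1, one_pos, hx⟩
  have hmem : ∀ n : ℕ, (perm w)^[n] x ∈ {x | perm w x ≠ x} := by
    intro n
    induction n with
    | zero => exact hx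
    | succ n ih =>
      rw [Function.iterate_succ_apply']
      exact fun h => ih ((perm w).injective h)
  obtain ⟨m, -, n, -, hmn, h⟩ := Set.infinite_univ.exists_ne_map_eq_of_mapsTo
    (f := fun n : ℕ => (perm w)^[n] x) (fun n _ => hmem n) (finite_perm_ne w)
  wlog hlt : m < n generalizing m n
  · exact this n m hmn.symm h.symm (by omega)
  refine ⟨n - m, by omega, ?_⟩
  have h' : (perm w)^[m] ((perm w)^[n - m] x) = (perm w)^[m] x := by
    rw [← Function.iterate_add_apply, Nat.add_sub_cancel' hlt.le]; exact h.symm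
  exact (perm w).injective.iterate m h'

theorem perm_pow_period (w : Wreath H X) (x : X) : perm (w ^ period w x) x = x := by
  rw [perm_pow_apply]; exact Function.iterate_minimalPeriod

/-- The type of the cycle through `x`: its length and the conjugacy class of its cycle product. -/
def orbitType (w : Wreath H X) (x : X) : ℕ × ConjClasses H :=
  (period w x, ConjClasses.mk (cocycle (w ^ period w x) x))

theorem period_conj (u w : Wreath H X) (x : X) :
    period (u * w * u⁻¹) (perm u x) = period w x := by
  apply Function.minimalPeriod_eq_minimalPeriod_iff.2
  intro n
  simp only [Function.IsPeriodicPt, Function.IsFixedPt, ← perm_pow_apply, conj_pow]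
  simp

/-- The power of `w` by the period fixes `x`, so the cocycle of `u` enters on both sides at the same
point `x` and conjugates the cycle product by `cocycle u x`. -/
theorem orbitType_conj (u w : Wreath H X) (x : X) :
    orbitType (u * w * u⁻¹) (perm u x) = orbitType w x := by
  rw [orbitType, orbitType, period_conj]
  congr 1
  rw [ConjClasses.mk_eq_mk_iff_isConj, conj_pow, cocycle_mul, cocycle_mul, cocycle_inv]
  have hx : (perm u⁻¹) (perm u x) = x := (perm u).symm_apply_apply x
  rw [hx, perm_pow_period]
  exact (isConj_iff.2 ⟨cocycle u x, rfl⟩).symm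

theorem orbitType_perm (w : Wreath H X) (x : X) : orbitType w (perm w x) = orbitType w x := by
  -- Moving along a cycle of `w` is conjugation of `w` by itself.
  simpa using orbitType_conj w w x

theorem orbitType_sameCycle {w : Wreath H X} {x y : X} (h : (perm w).SameCycle x y) :
    orbitType w x = orbitType w y := by
  obtain ⟨i, rfl⟩ := h
  have hn : ∀ (n : ℕ) (z : X), orbitType w ((perm w ^ n) z) = orbitType w z := by
    intro n
    induction n with
    | zero => intro z; rfl
    | succ n ih => intro z; rw [pow_succ, Equiv.Perm.mul_apply, ih, orbitType_perm]
  cases i with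
  | ofNat n => exact (hn n x).symm
  | negSucc n =>
    have := hn (n + 1) ((perm w ^ Int.negSucc n) x)
    rw [zpow_negSucc, show (perm w ^ (n + 1)) ((perm w ^ (n + 1))⁻¹ x) = x from
      (perm w ^ (n + 1)).apply_symm_apply x] at this
    rw [zpow_negSucc]; exact this

/-- The type at `x` only sees the forward orbit of `x`, which never leaves `A`. This makes types
local, so that products with disjoint supports can be treated factor by factor. -/
theorem orbitType_congr {w v : Wreath H X} {A : Set X} (hA : ∀ x ∈ A, perm w x ∈ A)
    (hp : ∀ x ∈ A, perm w x = perm v x) (hc : ∀ x ∈ A, cocycle w x = cocycle v x)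
    {x : X} (hx : x ∈ A) : orbitType w x = orbitType v x := by
  have key : ∀ n : ℕ, perm (w ^ n) x ∈ A ∧ perm (w ^ n) x = perm (v ^ n) x ∧
      cocycle (w ^ n) x = cocycle (v ^ n) x := by
    intro n
    induction n with
    | zero => simpa using hx
    | succ n ih =>
      obtain ⟨h1, h2, h3⟩ := ih
      simp only [pow_succ', perm_mul, cocycle_mul, Equiv.Perm.mul_apply]
      exact ⟨hA _ h1, by rw [hp _ h1, h2], by rw [hc _ h1, h2, h3]⟩
  have hper : period w x = period v x := by
    apply Function.minimalPeriod_eq_minimalPeriod_iff.2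
    intro n
    simp only [Function.IsPeriodicPt, Function.IsFixedPt, ← perm_pow_apply, (key n).2.1]
  rw [orbitType, orbitType, hper, (key _).2.2]

/-- The type of the points that are not moved. -/
def trivialType (H : Type*) [Group H] : ℕ × ConjClasses H := (1, ConjClasses.mk 1)

theorem orbitType_eq_trivialType {w : Wreath H X} {x : X} :
    orbitType w x = trivialType H ↔ perm w x = x ∧ cocycle w x = 1 := by
  rw [orbitType, trivialType, Prod.mk.injEq, ConjClasses.mk_eq_mk_iff_isConj, isConj_one_left,
    period, Function.minimalPeriod_eq_one_iff_isFixedPt]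
  refine and_congr_right fun h => ?_
  rw [Function.minimalPeriod_eq_one_iff_isFixedPt.2 h, pow_one]

/-- The points of nontrivial cycles, including the fixed points with nontrivial cycle product. -/
def moved (w : Wreath H X) : Set X := {x | orbitType w x ≠ trivialType H}

theorem mem_moved {w : Wreath H X} {x : X} :
    x ∈ moved w ↔ perm w x ≠ x ∨ cocycle w x ≠ 1 := by
  rw [moved, Set.mem_ofPred_eq, Ne, orbitType_eq_trivialType]; tauto

theorem moved_finite (w : Wreath H X) : (moved w).Finite :=
  ((finite_perm_ne w).union (finite_cocycle_ne w)).subset fun _ hx => mem_moved.1 hx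

/-- A chosen representative of the cycle of `x`. -/
def rep (w : Wreath H X) (x : X) : X :=
  (Quotient.mk (Equiv.Perm.SameCycle.setoid (perm w)) x).out

theorem sameCycle_rep (w : Wreath H X) (x : X) : (perm w).SameCycle (rep w x) x :=
  Quotient.mk_out (s := Equiv.Perm.SameCycle.setoid (perm w)) x

theorem rep_eq_rep {w : Wreath H X} {x y : X} :
    rep w x = rep w y ↔ (perm w).SameCycle x y := by
  refine ⟨fun h => (sameCycle_rep w x).symm.trans (h ▸ sameCycle_rep w y), fun h => ?_⟩
  have := Quotient.sound (s := Equiv.Perm.SameCycle.setoid (perm w)) h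
  rw [rep, rep, this]

@[simp] theorem rep_rep (w : Wreath H X) (x : X) : rep w (rep w x) = rep w x :=
  rep_eq_rep.2 (sameCycle_rep w x)

@[simp] theorem orbitType_rep (w : Wreath H X) (x : X) : orbitType w (rep w x) = orbitType w x :=
  orbitType_sameCycle (sameCycle_rep w x)

theorem exists_pow_rep (w : Wreath H X) (x : X) : ∃ n : ℕ, perm (w ^ n) (rep w x) = x := by
  obtain ⟨i, hi⟩ := sameCycle_rep w x
  have hl : (0 : ℤ) < period w (rep w x) := by exact_mod_cast period_pos w _
  refine ⟨(i % period w (rep w x)).toNat, ?_⟩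
  have hz : (perm w ^ ((period w (rep w x) : ℤ) * (i / period w (rep w x)))) (rep w x) =
      rep w x := by
    rw [zpow_mul]
    apply Equiv.Perm.zpow_apply_eq_self_of_apply_eq_self
    rw [zpow_natCast, ← perm_pow, perm_pow_period]
  rw [perm_pow, ← zpow_natCast, Int.toNat_of_nonneg (Int.emod_nonneg _ hl.ne')]
  conv_rhs => rw [← hi, ← Int.emod_add_mul_ediv i (period w (rep w x))]
  rw [zpow_add, Equiv.Perm.mul_apply, hz]

open Classical in
/-- One point on each nontrivial cycle. -/
def reps (w : Wreath H X) : Finset X := (moved_finite w).toFinset.image (rep w)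

theorem mem_reps {w : Wreath H X} {r : X} : r ∈ reps w ↔ r ∈ moved w ∧ rep w r = r := by
  simp only [reps, Finset.mem_image, Set.Finite.mem_toFinset]
  constructor
  · rintro ⟨x, hx, rfl⟩
    exact ⟨by rwa [moved, Set.mem_ofPred_eq, orbitType_rep], rep_rep w x⟩
  · rintro ⟨h1, h2⟩
    exact ⟨r, h1, h2⟩

theorem rep_mem_reps {w : Wreath H X} {x : X} (hx : x ∈ moved w) : rep w x ∈ reps w := by
  classical
  exact Finset.mem_image_of_mem _ ((moved_finite w).mem_toFinset.2 hx)

/-- The multiset of the types of the nontrivial cycles. -/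
def typeMultiset (w : Wreath H X) : Multiset (ℕ × ConjClasses H) :=
  (reps w).val.map (orbitType w)

theorem ncard_rep_eq (w : Wreath H X) {r : X} (hr : rep w r = r) :
    {x | rep w x = r}.ncard = period w r := by
  have : {x | rep w x = r} = (fun n : ℕ => (perm w)^[n] r) '' Set.Iio (period w r) := by
    ext x
    simp only [Set.mem_ofPred_eq, Set.mem_image, Set.mem_Iio]
    constructor
    · rintro rfl
      obtain ⟨n, hn⟩ := exists_pow_rep w x
      refine ⟨n % period w (rep w x), Nat.mod_lt _ (period_pos _ _), ?_⟩
      exact Function.iterate_mod_minimalPeriod_eq.trans ((perm_pow_apply w n _).symm.trans hn)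
    · rintro ⟨n, -, rfl⟩
      conv_rhs => rw [← hr]
      rw [rep_eq_rep]
      refine Equiv.Perm.SameCycle.symm ⟨n, ?_⟩
      rw [zpow_natCast, ← perm_pow, perm_pow_apply]
  have hinj : Set.InjOn (fun n : ℕ => (perm w)^[n] r) (Set.Iio (period w r)) :=
    Function.iterate_injOn_Iio_minimalPeriod
  rw [this, hinj.ncard_image, ← Finset.coe_Iio,
    Set.ncard_coe_finset, Nat.card_Iio]

theorem finite_orbitType_eq (w : Wreath H X) {p : ℕ × ConjClasses H} (hp : p ≠ trivialType H) :
    {x | orbitType w x = p}.Finite :=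
  (moved_finite w).subset fun x hx => by rw [moved, Set.mem_ofPred_eq, hx]; exact hp

open Classical in
theorem card_filter_rep (w : Wreath H X) {r : X} (hr : r ∈ reps w) {s : Finset X}
    (hs : ∀ x, rep w x = r → x ∈ s) : (s.filter fun x => rep w x = r).card = period w r := by
  rw [← ncard_rep_eq w (mem_reps.1 hr).2, ← Set.ncard_coe_finset]
  congr 1
  ext x
  simpa using hs x

-- Each cycle of type `p` consists of `p.1` points, all of type `p`. Multiplicities are thereby read
-- off from sets of points, independently of the chosen representatives.
open Classical in
theorem ncard_orbitType_eq (w : Wreath H X) {p : ℕ × ConjClasses H} (hp : p ≠ trivialType H) :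
    {x | orbitType w x = p}.ncard = p.1 * (typeMultiset w).count p := by
  rw [Set.ncard_eq_toFinset_card _ (finite_orbitType_eq w hp), typeMultiset, Multiset.count_map]
  have hmaps : ∀ x ∈ (finite_orbitType_eq w hp).toFinset,
      rep w x ∈ (reps w).filter fun r => p = orbitType w r := by
    intro x hx
    rw [Set.Finite.mem_toFinset, Set.mem_ofPred_eq] at hx
    rw [Finset.mem_filter]
    refine ⟨rep_mem_reps ?_, by rw [orbitType_rep, hx]⟩
    rw [moved, Set.mem_ofPred_eq, hx]; exact hp
  rw [Finset.card_eq_sum_card_fiberwise hmaps, Finset.sum_congr rfl (g := fun _ => p.1),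
    Finset.sum_const, smul_eq_mul, mul_comm]
  · rfl
  · intro r hr
    rw [Finset.mem_filter] at hr
    rw [card_filter_rep w hr.1, hr.2]
    · rfl
    · rintro x rfl
      rw [Set.Finite.mem_toFinset, Set.mem_ofPred_eq, hr.2, orbitType_rep]

open Classical in
theorem card_moved (w : Wreath H X) :
    (moved_finite w).toFinset.card = ((typeMultiset w).map Prod.fst).sum := by
  rw [typeMultiset, Multiset.map_map, Finset.card_eq_sum_card_fiberwise
    (f := rep w) (t := reps w)]
  · refine Finset.sum_congr rfl fun r hr => card_filter_rep w hr ?_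
    rintro x rfl
    rw [Set.Finite.mem_toFinset, moved, Set.mem_ofPred_eq, ← orbitType_rep]
    exact (mem_reps.1 hr).1
  · intro x hx
    exact rep_mem_reps ((moved_finite w).mem_toFinset.1 hx)

theorem ne_trivialType_of_mem {w : Wreath H X} {p : ℕ × ConjClasses H}
    (hp : p ∈ typeMultiset w) : p ≠ trivialType H ∧ 0 < p.1 := by
  obtain ⟨r, hr, rfl⟩ := Multiset.mem_map.1 hp
  exact ⟨(mem_reps.1 hr).1, period_pos w r⟩

theorem typeMultiset_eq {w v : Wreath H X}
    (h : ∀ p : ℕ × ConjClasses H, 0 < p.1 → p ≠ trivialType H →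
      {x | orbitType w x = p}.ncard = {x | orbitType v x = p}.ncard) :
    typeMultiset w = typeMultiset v := by
  classical
  ext p
  by_cases hp : 0 < p.1 ∧ p ≠ trivialType H
  · have := h p hp.1 hp.2
    rw [ncard_orbitType_eq w hp.2, ncard_orbitType_eq v hp.2] at this
    exact Nat.eq_of_mul_eq_mul_left hp.1 this
  · rw [Multiset.count_eq_zero_of_notMem, Multiset.count_eq_zero_of_notMem]
    all_goals
      intro hmem
      have := ne_trivialType_of_mem hmem
      exact hp ⟨this.2, this.1⟩

theorem typeMultiset_conj (u w : Wreath H X) :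
    typeMultiset (u * w * u⁻¹) = typeMultiset w := by
  refine typeMultiset_eq fun p _ _ => ?_
  rw [← Set.ncard_image_of_injective {x | orbitType w x = p} (perm u).injective]
  congr 1
  ext x
  rw [Equiv.image_eq_preimage_symm, Set.mem_preimage, Set.mem_ofPred_eq, Set.mem_ofPred_eq,
    ← orbitType_conj u w, Equiv.apply_symm_apply]

end Action

/-! ### Equal cycle types imply conjugacy -/

section Conjugacy

variable {H X : Type*} [Group H]

theorem perm_pow_apply_eq_iff (w : Wreath H X) (x : X) {i j : ℕ} (hij : i ≤ j) :
    perm (w ^ i) x = perm (w ^ j) x ↔ period w x ∣ j - i := by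
  rw [period, ← Function.isPeriodicPt_iff_minimalPeriod_dvd, Function.IsPeriodicPt,
    Function.IsFixedPt, perm_pow_apply, perm_pow_apply]
  conv_lhs => rw [← Nat.add_sub_cancel' hij, Function.iterate_add_apply]
  rw [((perm w).injective.iterate i).eq_iff, eq_comm]

theorem perm_pow_apply_eq_congr {w v : Wreath H X} {x y : X} (h : period w x = period v y)
    {i j : ℕ} (hij : perm (w ^ i) x = perm (w ^ j) x) :
    perm (v ^ i) y = perm (v ^ j) y := by
  wlog hle : i ≤ j generalizing i j
  · exact (this hij.symm (by omega)).symm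
  rw [perm_pow_apply_eq_iff v y hle, ← h, ← perm_pow_apply_eq_iff w x hle]
  exact hij

theorem cocycle_pow_of_fixed {w : Wreath H X} {x : X} (h : perm w x = x) (k : ℕ) :
    cocycle (w ^ k) x = cocycle w x ^ k := by
  induction k with
  | zero => simp
  | succ k ih => rw [pow_succ, cocycle_mul, h, ih, pow_succ]

/-- This makes the conjugating function well defined along a cycle. The exponents differ by a
multiple of the period; the extra factors are equal powers of the two cycle products, which `a`
intertwines, so they cancel. -/
theorem cocycle_pow_congr {w v : Wreath H X} {x y : X} (h : period w x = period v y) {a : H}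
    (ha : a * cocycle (w ^ period w x) x * a⁻¹ = cocycle (v ^ period v y) y)
    {i j : ℕ} (hij : perm (w ^ i) x = perm (w ^ j) x) :
    cocycle (v ^ i) y * a * (cocycle (w ^ i) x)⁻¹ =
      cocycle (v ^ j) y * a * (cocycle (w ^ j) x)⁻¹ := by
  wlog hle : i ≤ j generalizing i j
  · exact (this hij.symm (by omega)).symm
  obtain ⟨k, hk⟩ := (perm_pow_apply_eq_iff w x hle).1 hij
  obtain rfl : j = i + period w x * k := by omega
  have hfix : ∀ (u : Wreath H X) (z : X), perm ((u ^ period u z) ^ k) z = z := by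
    intro u z
    rw [perm_pow_apply]
    exact Function.iterate_fixed (perm_pow_period u z) k
  conv_rhs => rw [pow_add, pow_add, pow_mul, pow_mul, cocycle_mul, cocycle_mul, hfix w x,
    cocycle_pow_of_fixed (perm_pow_period w x), h, hfix v y,
    cocycle_pow_of_fixed (perm_pow_period v y), ← ha, conj_pow, h]
  group

theorem exists_equiv_of_map_eq {α β γ : Type*} {s : Finset α} {t : Finset β} {f : α → γ}
    {g : β → γ} (h : s.val.map f = t.val.map g) : ∃ e : s ≃ t, ∀ x, g (e x) = f x := by
  classical
  have hs : (Finset.univ : Finset s).val.map (fun x : s => f x) = s.val.map f :=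
    Multiset.attach_map_val' s.val f
  have ht : (Finset.univ : Finset t).val.map (fun x : t => g x) = t.val.map g :=
    Multiset.attach_map_val' t.val g
  rw [← hs, ← ht] at h
  have hc : ∀ p : γ, Fintype.card {x : s // f x = p} = Fintype.card {x : t // g x = p} := by
    intro p
    have := congrArg (Multiset.count p) h
    rw [Multiset.count_map, Multiset.count_map] at this
    rw [Fintype.card_subtype, Fintype.card_subtype]
    simpa only [eq_comm, Finset.card_def, Finset.filter_val] using this
  exact ⟨Equiv.ofFiberEquiv (f := fun x : s => f x) (g := fun x : t => g x)
      fun p => Fintype.equivOfCardEq (hc p),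
    fun x => Equiv.ofFiberEquiv_map (f := fun x : s => f x)
      (g := fun x : t => g x) (fun p => Fintype.equivOfCardEq (hc p)) x⟩

/-- The injection extends to a permutation of the finite set `F ∪ g(F)`, which is then continued by
the identity. -/
theorem exists_finitarySym_extend {F : Set X} (hF : F.Finite) {g : X → X} (hg : F.InjOn g) :
    ∃ σ : FinitarySym X, ∀ x ∈ F, σ.1 x = g x := by
  classical
  let E : Finset X := hF.toFinset ∪ hF.toFinset.image g
  obtain ⟨e, he⟩ := Set.MapsTo.exists_equiv_extend_of_card_eq (α := E) (t := E)
    (Fintype.card_coe E) (s := Subtype.val ⁻¹' F) (f := fun x => g x)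
    (fun x hx => by
      simp only [E, Finset.coe_union, Finset.coe_image, Set.Finite.coe_toFinset]
      exact Or.inr ⟨x, hx, rfl⟩)
    (fun x hx y hy hxy => Subtype.ext (hg hx hy hxy))
  refine ⟨⟨Equiv.Perm.ofSubtype e, ?_⟩, fun x hx => ?_⟩
  · refine E.finite_toSet.subset fun x hx => ?_
    by_contra h
    exact hx (Equiv.Perm.ofSubtype_apply_of_not_mem e h)
  · have hxE : x ∈ E := Finset.mem_union_left _ (hF.mem_toFinset.2 hx)
    rw [← he ⟨x, hxE⟩ hx]
    exact Equiv.Perm.ofSubtype_apply_of_mem e hxE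

theorem perm_mem_moved {w : Wreath H X} {x : X} : perm w x ∈ moved w ↔ x ∈ moved w := by
  rw [moved, Set.mem_ofPred_eq, Set.mem_ofPred_eq, orbitType_perm]

theorem rep_perm (w : Wreath H X) (x : X) : rep w (perm w x) = rep w x :=
  rep_eq_rep.2 (Equiv.Perm.sameCycle_apply_left.2 (Equiv.Perm.SameCycle.refl _ _))

theorem rep_perm_pow (w : Wreath H X) (n : ℕ) (x : X) : rep w (perm (w ^ n) x) = rep w x := by
  induction n with
  | zero => rfl
  | succ n ih => rw [pow_succ', perm_mul, Equiv.Perm.mul_apply, rep_perm, ih]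

/-- Elements of the wreath product whose nontrivial cycles have the same types are conjugate. -/
theorem isConj_of_typeMultiset_eq {w v : Wreath H X} (h : typeMultiset w = typeMultiset v) :
    IsConj w v := by
  classical
  obtain ⟨e, he⟩ := exists_equiv_of_map_eq h
  have hper : ∀ r : reps w, period w r = period v (e r) := fun r => congrArg Prod.fst (he r).symm
  have hconj : ∀ r : reps w, ∃ a : H,
      a * cocycle (w ^ period w (r : X)) r * a⁻¹ = cocycle (v ^ period v (e r : X)) (e r) := by
    intro r
    have := congrArg Prod.snd (he r).symm
    exact isConj_iff.1 (ConjClasses.mk_eq_mk_iff_isConj.1 this)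
  choose a ha using hconj
  choose k hk using exists_pow_rep w
  let ρ : ∀ x, x ∈ moved w → reps w := fun x hx => ⟨rep w x, rep_mem_reps hx⟩
  -- The conjugator is built by transport along cycles: `g` sends `w^n r` to `v^n (e r)`, and `b` is
  -- the function value forced by the intertwining relation once its value at `r` is `a r`.
  let g : X → X := fun x => if hx : x ∈ moved w then perm (v ^ k x) (e (ρ x hx)) else x
  let b : X → H := fun x => if hx : x ∈ moved w then
    cocycle (v ^ k x) (e (ρ x hx)) * a (ρ x hx) * (cocycle (w ^ k x) (rep w x))⁻¹ else 1
  have hgb : ∀ (r : reps w) (n : ℕ), perm (w ^ n) r ∈ moved w ∧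
      g (perm (w ^ n) r) = perm (v ^ n) (e r) ∧
      b (perm (w ^ n) r) = cocycle (v ^ n) (e r) * a r * (cocycle (w ^ n) r)⁻¹ := by
    intro r n
    have hr := mem_reps.1 r.2
    have hrep : rep w (perm (w ^ n) r) = r := (rep_perm_pow w n r).trans hr.2
    have hm : perm (w ^ n) r ∈ moved w := by
      rw [moved, Set.mem_ofPred_eq, ← orbitType_rep, hrep]; exact hr.1
    have hρ : ρ _ hm = r := Subtype.ext hrep
    have hkn : perm (w ^ k (perm (w ^ n) r)) r = perm (w ^ n) r := by
      conv_lhs => rw [← hrep]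
      rw [hrep]
      have := hk (perm (w ^ n) r)
      rwa [hrep] at this
    refine ⟨hm, ?_, ?_⟩
    · simp only [g, dif_pos hm, hρ]
      exact perm_pow_apply_eq_congr (hper r) hkn
    · simp only [b, dif_pos hm, hρ, hrep]
      exact cocycle_pow_congr (hper r) (ha r) hkn
  have hstep : ∀ x ∈ moved w, g (perm w x) = perm v (g x) ∧
      b (perm w x) * cocycle w x = cocycle v (g x) * b x := by
    intro x hx
    have h1 := hgb (ρ x hx) (k x)
    have h2 := hgb (ρ x hx) (k x + 1)
    simp only [pow_succ', perm_mul, cocycle_mul, Equiv.Perm.mul_apply] at h2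
    have hkx : perm (w ^ k x) (ρ x hx : X) = x := hk x
    rw [hkx] at h1 h2
    refine ⟨by rw [h2.2.1, h1.2.1], ?_⟩
    rw [h2.2.2, h1.2.2, h1.2.1]
    group
  have hginj : (moved w).InjOn g := by
    intro x hx y hy hxy
    have h1 : g x = perm (v ^ k x) (e (ρ x hx)) := dif_pos hx
    have h2 : g y = perm (v ^ k y) (e (ρ y hy)) := dif_pos hy
    have h3 : rep v (g x) = e (ρ x hx) := by
      rw [h1, rep_perm_pow]; exact (mem_reps.1 (e (ρ x hx)).2).2
    have h4 : rep v (g y) = e (ρ y hy) := by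
      rw [h2, rep_perm_pow]; exact (mem_reps.1 (e (ρ y hy)).2).2
    have h5 : ρ x hx = ρ y hy := by
      apply e.injective
      apply Subtype.ext
      rw [← h3, ← h4, hxy]
    have h6 : perm (v ^ k x) (e (ρ x hx) : X) = perm (v ^ k y) (e (ρ x hx)) := by
      rw [← h1, hxy, h2, h5]
    have h7 := perm_pow_apply_eq_congr (hper (ρ x hx)).symm h6
    have h8 : perm (w ^ k y) (ρ x hx : X) = y := by rw [h5]; exact hk y
    exact (hk x).symm.trans (h7.trans h8)
  have hgsurj : ∀ y ∈ moved v, ∃ x ∈ moved w, g x = y := by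
    intro y hy
    obtain ⟨n, hn⟩ := exists_pow_rep v y
    obtain ⟨r, hr⟩ := e.surjective ⟨rep v y, rep_mem_reps hy⟩
    refine ⟨_, (hgb r n).1, ?_⟩
    rw [(hgb r n).2.1, hr]
    exact hn
  obtain ⟨σ, hσ⟩ := exists_finitarySym_extend (moved_finite w) hginj
  let ψ : X → H := fun y => b (σ.1.symm y)
  have hψ : (Function.mulSupport ψ).Finite := by
    refine ((moved_finite w).preimage (f := σ.1.symm) σ.1.symm.injective.injOn).subset ?_
    intro y hy
    by_contra hn
    exact hy (dif_neg hn)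
  let u : Wreath H X := ⟨⟨ψ, hψ⟩, σ⟩
  have hu1 : ∀ x, perm u x = σ.1 x := fun x => rfl
  have hu2 : ∀ x, cocycle u x = b x := fun x => congrArg b (σ.1.symm_apply_apply x)
  have huw : u * w = v * u := by
    have key : ∀ x, perm (u * w) x = perm (v * u) x ∧ cocycle (u * w) x = cocycle (v * u) x := by
      intro x
      simp only [perm_mul, cocycle_mul, Equiv.Perm.mul_apply, hu1, hu2]
      by_cases hx : x ∈ moved w
      · rw [hσ x hx, hσ _ (perm_mem_moved.2 hx)]
        exact hstep x hx
      -- Off `moved w` nothing is known about the extension `σ`, but `g` already covers all of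
      -- `moved v`, so injectivity keeps `σ x` out of it.
      · have hσx : σ.1 x ∉ moved v := by
          intro hm
          obtain ⟨x', hx', hg⟩ := hgsurj _ hm
          rw [← hσ x' hx'] at hg
          exact hx (σ.1.injective hg ▸ hx')
        have h1 := orbitType_eq_trivialType.1 (not_not.1 hx)
        have h2 := orbitType_eq_trivialType.1 (not_not.1 hσx)
        rw [h1.1, h1.2, h2.1, h2.2, mul_one, one_mul]
        exact ⟨rfl, rfl⟩
    exact ext_action (fun x => (key x).1) fun x => (key x).2
  exact isConj_iff.2 ⟨u, by rw [huw, mul_inv_cancel_right]⟩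

end Conjugacy

/-! ### Lower bound for word length by linear algebra -/

section LowerBound

variable {H X : Type*} [Group H]

open Classical in
/-- The conjugacy length contributed by a cycle of type `p`. -/
def typeWeight (p : ℕ × ConjClasses H) : ℕ :=
  if p.2 = ConjClasses.mk 1 then p.1 - 1 else p.1

/-- `U` contains all `e_x - e_{w x}`, and all `e_x` at which the cocycle of `w` is nontrivial. -/
def Controls (U : Submodule ℚ (X →₀ ℚ)) (w : Wreath H X) : Prop :=
  ∀ x, Finsupp.single x (1 : ℚ) - Finsupp.single (perm w x) 1 ∈ U ∧
    (cocycle w x ≠ 1 → Finsupp.single x (1 : ℚ) ∈ U)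

theorem Controls.mono {U V : Submodule ℚ (X →₀ ℚ)} (h : U ≤ V) {w : Wreath H X}
    (hw : Controls U w) : Controls V w :=
  fun x => ⟨h (hw x).1, fun hx => h ((hw x).2 hx)⟩

theorem controls_one (U : Submodule ℚ (X →₀ ℚ)) : Controls U (1 : Wreath H X) := by
  intro x; simp

/-- Differences telescope along `x`, `v x`, `w v x`. A nontrivial cocycle of the product at `x`
comes from `v` at `x` or from `w` at `v x`; in the latter case the difference transports the basis
vector back to `x`. -/
theorem Controls.mul {U : Submodule ℚ (X →₀ ℚ)} {w v : Wreath H X} (hw : Controls U w)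
    (hv : Controls U v) : Controls U (w * v) := by
  intro x
  refine ⟨?_, fun h => ?_⟩
  · simpa using U.add_mem (hv x).1 (hw (perm v x)).1
  · by_cases h1 : cocycle v x = 1
    · rw [cocycle_mul, h1, mul_one] at h
      simpa using U.add_mem (hv x).1 ((hw _).2 h)
    · exact (hv x).2 h1

theorem Controls.pow {U : Submodule ℚ (X →₀ ℚ)} {w : Wreath H X} (hw : Controls U w) (n : ℕ) :
    Controls U (w ^ n) := by
  induction n with
  | zero => exact controls_one U
  | succ n ih => rw [pow_succ]; exact ih.mul hw

theorem Controls.inv {U : Submodule ℚ (X →₀ ℚ)} {w : Wreath H X} (hw : Controls U w) :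
    Controls U w⁻¹ := by
  intro x
  obtain ⟨y, rfl⟩ := (perm w).surjective x
  have hy : perm w⁻¹ (perm w y) = y := (perm w).symm_apply_apply y
  rw [hy, cocycle_inv]
  refine ⟨?_, fun h => ?_⟩
  · simpa using U.neg_mem (hw y).1
  · simpa using U.sub_mem ((hw y).2 (by simpa using h)) (hw y).1

/-- The set of all elements supported at one point, and of all transpositions. -/
def letters (H X : Type*) [Group H] : Set (Wreath H X) :=
  SemidirectProduct.inl '' TH H X ∪ SemidirectProduct.inr '' TX X

@[simp] theorem perm_inl (φ : FinSuppFun H X) : perm (SemidirectProduct.inl φ : Wreath H X) = 1 :=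
  rfl

@[simp] theorem cocycle_inl (φ : FinSuppFun H X) (x : X) :
    cocycle (SemidirectProduct.inl φ : Wreath H X) x = φ.1 x := rfl

@[simp] theorem perm_inr (f : FinitarySym X) :
    perm (SemidirectProduct.inr f : Wreath H X) = f.1 := rfl

@[simp] theorem cocycle_inr (f : FinitarySym X) (x : X) :
    cocycle (SemidirectProduct.inr f : Wreath H X) x = 1 := rfl

theorem single_apply_of_ne {x u : X} (h : x ≠ u) (a : H) : (single u a).1 x = 1 := by
  simp [single, h]

theorem single_apply_self (u : X) (a : H) : (single u a).1 u = a := by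
  simp [single]

/-- One vector per letter is what makes word length bound a dimension. -/
theorem exists_controls_of_mem_letters {s : Wreath H X} (hs : s ∈ letters H X) :
    ∃ e : X →₀ ℚ, ∀ U : Submodule ℚ (X →₀ ℚ), e ∈ U → Controls U s := by
  classical
  rcases hs with ⟨_, ⟨u, a, -, rfl⟩, rfl⟩ | ⟨_, ⟨y, z, -, rfl⟩, rfl⟩
  · refine ⟨Finsupp.single u 1, fun U hU x => ⟨by simp, fun hx => ?_⟩⟩
    rw [cocycle_inl] at hx
    obtain rfl : x = u := by
      by_contra hne
      exact hx (single_apply_of_ne hne a)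
    exact hU
  · refine ⟨Finsupp.single y 1 - Finsupp.single z 1, fun U hU x => ⟨?_, by simp⟩⟩
    have hx : perm (SemidirectProduct.inr (transposition y z) : Wreath H X) x =
      Equiv.swap y z x := by simp [transposition]
    rw [hx]
    rcases eq_or_ne x y with rfl | h1
    · rwa [Equiv.swap_apply_left]
    rcases eq_or_ne x z with rfl | h2
    · rw [Equiv.swap_apply_right, ← neg_sub]; exact U.neg_mem hU
    · rw [Equiv.swap_apply_of_ne_of_ne h1 h2, sub_self]; exact U.zero_mem

theorem exists_controls_of_word (l : List (Wreath H X))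
    (hl : ∀ s ∈ l, s ∈ letters H X ∨ s⁻¹ ∈ letters H X) :
    ∃ t : Finset (X →₀ ℚ), t.card ≤ l.length ∧
      Controls (Submodule.span ℚ (t : Set (X →₀ ℚ))) l.prod := by
  classical
  induction l with
  | nil => exact ⟨∅, le_rfl, controls_one _⟩
  | cons s l ih =>
    obtain ⟨t, ht, hc⟩ := ih fun s hs => hl s (List.mem_cons_of_mem _ hs)
    obtain ⟨e, he⟩ : ∃ e : X →₀ ℚ, ∀ U : Submodule ℚ (X →₀ ℚ), e ∈ U → Controls U s := by
      rcases hl s List.mem_cons_self with h | h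
      · exact exists_controls_of_mem_letters h
      · obtain ⟨e, he⟩ := exists_controls_of_mem_letters h
        exact ⟨e, fun U hU => inv_inv s ▸ (he U hU).inv⟩
    refine ⟨insert e t, (Finset.card_insert_le _ _).trans (by simpa using ht), ?_⟩
    rw [List.prod_cons]
    refine (he _ (Submodule.subset_span (by simp))).mul (hc.mono (Submodule.span_mono ?_))
    rw [Finset.coe_insert]
    exact Set.subset_insert _ _

/-- A word in the letters is at least as long as the total weight of the cycle types of its
product. -/
theorem sum_typeWeight_le_length (l : List (Wreath H X))
    (hl : ∀ s ∈ l, s ∈ letters H X ∨ s⁻¹ ∈ letters H X) :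
    ((typeMultiset l.prod).map typeWeight).sum ≤ l.length := by
  classical
  obtain ⟨t, ht, hc⟩ := exists_controls_of_word l hl
  generalize l.prod = w at *
  -- On cycles with trivial product the differences alone need not give any basis vector; adding the
  -- one at the representative yields the rest of the cycle.
  let B : Finset X := (reps w).filter fun r => (orbitType w r).2 = ConjClasses.mk 1
  let e : X → X →₀ ℚ := fun x => Finsupp.single x 1
  let V : Submodule ℚ (X →₀ ℚ) := Submodule.span ℚ ((t ∪ B.image e : Finset _) : Set (X →₀ ℚ))
  have hcV : Controls V w := hc.mono (Submodule.span_mono (by simp))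
  have hmem : ∀ x ∈ (moved_finite w).toFinset, e x ∈ V := by
    intro x hx
    have hr := rep_mem_reps ((moved_finite w).mem_toFinset.1 hx)
    have hrV : e (rep w x) ∈ V := by
      by_cases hB : (orbitType w (rep w x)).2 = ConjClasses.mk 1
      · refine Submodule.subset_span ?_
        rw [Finset.mem_coe, Finset.mem_union]
        exact Or.inr (Finset.mem_image_of_mem _ (Finset.mem_filter.2 ⟨hr, hB⟩))
      -- If the cycle product is nontrivial, it is the cocycle of a power of `w`, so the basis
      -- vector is already in the span.
      · refine ((hcV.pow (period w (rep w x))) (rep w x)).2 fun h => hB ?_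
        rw [orbitType, h]
    obtain ⟨n, hn⟩ := exists_pow_rep w x
    have := ((hcV.pow n) (rep w x)).1
    rw [hn] at this
    simpa [e] using V.sub_mem hrV this
  have hli : LinearIndependent ℚ fun x : (moved_finite w).toFinset => e x :=
    (Finsupp.linearIndependent_single_one ℚ X).comp _ Subtype.val_injective
  have h1 : (moved_finite w).toFinset.card ≤ t.card + B.card := by
    have h2 : Module.finrank ℚ (Submodule.span ℚ
        (Set.range fun x : (moved_finite w).toFinset => e x)) = (moved_finite w).toFinset.card := by
      rw [finrank_span_eq_card hli, Fintype.card_coe]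
    have h3 : Submodule.span ℚ (Set.range fun x : (moved_finite w).toFinset => e x) ≤ V := by
      rw [Submodule.span_le]
      rintro _ ⟨x, rfl⟩
      exact hmem x x.2
    rw [← h2]
    calc _ ≤ Module.finrank ℚ V := Submodule.finrank_mono h3
      _ ≤ (t ∪ B.image e).card := finrank_span_finset_le_card _
      _ ≤ t.card + (B.image e).card := Finset.card_union_le _ _
      _ ≤ _ := Nat.add_le_add_left Finset.card_image_le _
  rw [card_moved, typeMultiset, Multiset.map_map] at h1
  rw [typeMultiset, Multiset.map_map]
  -- Length exceeds weight by one exactly at the representatives in `B`, so the cardinality of `B`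
  -- cancels from the dimension bound.
  have h4 : ((reps w).val.map (Prod.fst ∘ orbitType w)).sum =
      ((reps w).val.map (typeWeight ∘ orbitType w)).sum + B.card := by
    change ∑ r ∈ reps w, (orbitType w r).1 = ∑ r ∈ reps w, typeWeight (orbitType w r) + B.card
    rw [Finset.card_filter, ← Finset.sum_add_distrib]
    refine Finset.sum_congr rfl fun r _ => ?_
    have hpos : 0 < (orbitType w r).1 := period_pos w r
    rw [typeWeight]
    split_ifs <;> omega
  omega

end LowerBound

/-! ### Disjoint products and single-cycle elements -/

section Blocks

variable {H X : Type*} [Group H]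

theorem typeMultiset_eq_of_ncard {w : Wreath H X} {m : Multiset (ℕ × ConjClasses H)}
    [DecidableEq (ℕ × ConjClasses H)]
    (hm : ∀ p ∈ m, p ≠ trivialType H ∧ 0 < p.1)
    (h : ∀ p : ℕ × ConjClasses H, p ≠ trivialType H →
      {x | orbitType w x = p}.ncard = p.1 * m.count p) :
    typeMultiset w = m := by
  ext p
  by_cases hp : p ≠ trivialType H ∧ 0 < p.1
  · have := h p hp.1
    rw [ncard_orbitType_eq w hp.1] at this
    convert Nat.eq_of_mul_eq_mul_left hp.2 this
  · rw [Multiset.count_eq_zero_of_notMem fun hmem => hp (ne_trivialType_of_mem hmem),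
      Multiset.count_eq_zero_of_notMem fun hmem => hp (hm p hmem)]

theorem not_mem_moved {w : Wreath H X} {x : X} :
    x ∉ moved w ↔ perm w x = x ∧ cocycle w x = 1 := by
  rw [moved, Set.mem_ofPred_eq, not_not, orbitType_eq_trivialType]

theorem orbitType_mul_of_mem_left {w v : Wreath H X} (h : Disjoint (moved w) (moved v)) {x : X}
    (hx : x ∈ moved w) : orbitType (w * v) x = orbitType w x := by
  symm
  refine orbitType_congr (A := moved w) (fun x hx => perm_mem_moved.2 hx) (fun y hy => ?_)
    (fun y hy => ?_) hx
  all_goals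
    have hv := not_mem_moved.1 (h.notMem_of_mem_left hy)
    simp [hv.1, hv.2]

theorem orbitType_mul_of_mem_right {w v : Wreath H X} (h : Disjoint (moved w) (moved v)) {x : X}
    (hx : x ∈ moved v) : orbitType (w * v) x = orbitType v x := by
  symm
  refine orbitType_congr (A := moved v) (fun x hx => perm_mem_moved.2 hx) (fun y hy => ?_)
    (fun y hy => ?_) hx
  all_goals
    have hw := not_mem_moved.1 (h.notMem_of_mem_right (perm_mem_moved.2 hy))
    simp [hw.1, hw.2]

theorem moved_mul_subset (w v : Wreath H X) : moved (w * v) ⊆ moved w ∪ moved v := by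
  intro x hx
  by_contra h
  rw [Set.mem_union, not_or] at h
  have h1 := not_mem_moved.1 h.1
  have h2 := not_mem_moved.1 h.2
  exact not_mem_moved.2 (by simp [h1.1, h1.2, h2.1, h2.2]) hx

theorem typeMultiset_mul {w v : Wreath H X} (h : Disjoint (moved w) (moved v)) :
    typeMultiset (w * v) = typeMultiset w + typeMultiset v := by
  classical
  refine typeMultiset_eq_of_ncard (fun p hp => ?_) fun p hp => ?_
  · rcases Multiset.mem_add.1 hp with hp | hp
    all_goals exact ne_trivialType_of_mem hp
  · rw [Multiset.count_add, mul_add]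
    have h1 := ncard_orbitType_eq w hp
    have h2 := ncard_orbitType_eq v hp
    have hmw : ∀ {u : Wreath H X} {x : X}, orbitType u x = p → x ∈ moved u :=
      fun hx => by rw [moved, Set.mem_ofPred_eq, hx]; exact hp
    rw [← h1, ← h2, ← Set.ncard_union_eq _ (finite_orbitType_eq w hp) (finite_orbitType_eq v hp)]
    · congr 1
      ext x
      rw [Set.mem_union, Set.mem_ofPred_eq, Set.mem_ofPred_eq, Set.mem_ofPred_eq]
      constructor
      · intro hx
        rcases moved_mul_subset w v (hmw hx) with hm | hm
        · exact Or.inl (orbitType_mul_of_mem_left h hm ▸ hx)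
        · exact Or.inr (orbitType_mul_of_mem_right h hm ▸ hx)
      · rintro (hx | hx)
        · rw [orbitType_mul_of_mem_left h (hmw hx), hx]
        · rw [orbitType_mul_of_mem_right h (hmw hx), hx]
    · exact h.mono (fun x hx => hmw hx) fun x hx => hmw hx

theorem typeMultiset_one : typeMultiset (1 : Wreath H X) = 0 := by
  classical
  refine typeMultiset_eq_of_ncard (fun p hp => absurd hp (Multiset.notMem_zero p)) fun p hp => ?_
  rw [Multiset.count_zero, mul_zero, Set.ncard_eq_zero (finite_orbitType_eq _ hp)]
  refine Set.eq_empty_of_forall_notMem fun x hx => hp ?_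
  rw [← Set.mem_ofPred_eq.mp hx, orbitType_eq_trivialType]
  simp

/-- The second conjunct carries the induction: it shows that the head is disjoint from the product
of the tail. -/
theorem typeMultiset_list_prod (L : List (Wreath H X))
    (h : L.Pairwise fun w v => Disjoint (moved w) (moved v)) :
    typeMultiset L.prod = (L.map typeMultiset).sum ∧
      ∀ x ∈ moved L.prod, ∃ w ∈ L, x ∈ moved w := by
  induction L with
  | nil =>
    refine ⟨typeMultiset_one, fun x hx => ?_⟩
    exact absurd hx (not_mem_moved.2 (by simp))
  | cons w L ih =>
    rw [List.pairwise_cons] at h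
    obtain ⟨ih1, ih2⟩ := ih h.2
    rw [List.prod_cons, List.map_cons, List.sum_cons]
    refine ⟨?_, fun x hx => ?_⟩
    · rw [typeMultiset_mul, ih1]
      refine Set.disjoint_left.2 fun x hx hx' => ?_
      obtain ⟨v, hv, hxv⟩ := ih2 x hx'
      exact Set.disjoint_left.1 (h.1 v hv) hx hxv
    · rcases moved_mul_subset _ _ hx with hx | hx
      · exact ⟨w, List.mem_cons_self, hx⟩
      · obtain ⟨v, hv, hxv⟩ := ih2 x hx
        exact ⟨v, List.mem_cons_of_mem _ hv, hxv⟩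

/-- The element whose permutation is `f` and whose only nontrivial function value is `a`,
at `x`. -/
def block (x : X) (a : H) (f : FinitarySym X) : Wreath H X :=
  SemidirectProduct.inl (single x a) * SemidirectProduct.inr f

theorem perm_block (x : X) (a : H) (f : FinitarySym X) : perm (block x a f) = f.1 := by
  simp [block]

theorem cocycle_block (x : X) (a : H) (f : FinitarySym X) (z : X) :
    cocycle (block x a f) z = (single x a).1 (f.1 z) := by
  simp [block]

/-- `f` is a cycle on the finite set `B ∋ x`. -/
structure IsCycleAt (f : FinitarySym X) (B : Finset X) (x : X) : Prop where
  mem : x ∈ B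
  fixed : ∀ z ∉ B, f.1 z = z
  sameCycle : ∀ z ∈ B, f.1.SameCycle x z

theorem moved_block_subset {f : FinitarySym X} {B : Finset X} {x : X} (hf : IsCycleAt f B x)
    (a : H) : moved (block x a f) ⊆ B := by
  intro z hz
  by_contra hn
  refine not_mem_moved.2 ⟨?_, ?_⟩ hz
  · rw [perm_block, hf.fixed z hn]
  · rw [cocycle_block, hf.fixed z hn]
    exact single_apply_of_ne (fun h : z = x => hn (by rw [h]; exact hf.mem)) a

theorem period_block {f : FinitarySym X} {B : Finset X} {x : X} (hf : IsCycleAt f B x) (a : H) :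
    period (block x a f) x = B.card := by
  have h1 : period (block x a f) (rep (block x a f) x) = period (block x a f) x :=
    congrArg Prod.fst (orbitType_rep (block x a f) x)
  rw [← h1, ← ncard_rep_eq _ (rep_rep _ _), ← Set.ncard_coe_finset]
  congr 1
  ext z
  rw [Set.mem_ofPred_eq, rep_eq_rep, perm_block, Finset.mem_coe]
  refine ⟨fun h => ?_, fun h => (hf.sameCycle z h).symm⟩
  by_contra hn
  exact hn ((h.eq_of_left (hf.fixed z hn)) ▸ hf.mem)

/-- The factor `a` is collected only on arrival at `x`, which happens for the first time at the last
step of the period. -/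
theorem cocycle_block_pow_period (x : X) (a : H) (f : FinitarySym X) :
    cocycle (block x a f ^ period (block x a f) x) x = a := by
  set w := block x a f with hw
  have hcoc : ∀ n : ℕ, cocycle (w ^ (n + 1)) x =
      (single x a).1 (perm (w ^ (n + 1)) x) * cocycle (w ^ n) x := by
    intro n
    rw [pow_succ', cocycle_mul, perm_mul, hw, cocycle_block, perm_block, Equiv.Perm.mul_apply]
  have hlt : ∀ n : ℕ, n < period w x → cocycle (w ^ n) x = 1 := by
    intro n hn
    induction n with
    | zero => simp
    | succ n ih =>
      rw [hcoc, ih (by omega), mul_one]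
      refine single_apply_of_ne (fun h => ?_) a
      rw [perm_pow_apply] at h
      exact Function.not_isPeriodicPt_of_pos_of_lt_minimalPeriod (by omega) hn h
  obtain ⟨n, hn⟩ := Nat.exists_eq_succ_of_ne_zero (period_pos w x).ne'
  have := hcoc n
  rw [← Nat.succ_eq_add_one, ← hn, perm_pow_period, single_apply_self, hlt n (by omega),
    mul_one] at this
  exact this

theorem typeMultiset_block {f : FinitarySym X} {B : Finset X} {x : X} (hf : IsCycleAt f B x)
    {a : H} (hne : ((B.card, ConjClasses.mk a) : ℕ × ConjClasses H) ≠ trivialType H) :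
    typeMultiset (block x a f) = {(B.card, ConjClasses.mk a)} := by
  classical
  have hx : orbitType (block x a f) x = (B.card, ConjClasses.mk a) := by
    rw [orbitType, cocycle_block_pow_period, period_block hf]
  have hB : ∀ z ∈ B, orbitType (block x a f) z = (B.card, ConjClasses.mk a) := by
    intro z hz
    rw [← hx]
    exact (orbitType_sameCycle (by rw [perm_block]; exact hf.sameCycle z hz)).symm
  refine typeMultiset_eq_of_ncard (fun p hp => ?_) fun p hp => ?_
  · rw [Multiset.mem_singleton.1 hp]
    exact ⟨hne, Finset.card_pos.2 ⟨x, hf.mem⟩⟩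
  · have hsub : ∀ z, orbitType (block x a f) z = p → z ∈ B := fun z hz =>
      moved_block_subset hf a (by rw [moved, Set.mem_ofPred_eq, hz]; exact hp)
    rw [Multiset.count_singleton]
    split_ifs with h
    · subst h
      have h1 : {z | orbitType (block x a f) z = (B.card, ConjClasses.mk a)} = (B : Set X) :=
        Set.ext fun z => ⟨hsub z, hB z⟩
      rw [h1, Set.ncard_coe_finset, mul_one]
    · rw [mul_zero, Set.ncard_eq_zero (finite_orbitType_eq _ hp)]
      refine Set.eq_empty_of_forall_notMem fun z hz => h ?_
      rw [← hB z (hsub z hz)]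
      exact (Set.mem_ofPred_eq.mp hz).symm

theorem isCycleAt_one (x : X) : IsCycleAt (1 : FinitarySym X) {x} x where
  mem := Finset.mem_singleton_self x
  fixed _ _ := rfl
  sameCycle z hz := by rw [Finset.mem_singleton.1 hz]

-- Multiplying on the right by `(b y)` inserts `y` into the cycle between `b` and `f b`.
open Classical in
theorem IsCycleAt.mul_transposition {f : FinitarySym X} {B : Finset X} {x b y : X}
    (hf : IsCycleAt f B x) (hb : b ∈ B) (hy : y ∉ B) :
    IsCycleAt (f * transposition b y) (insert y B) x := by
  have hval : ∀ z, (f * transposition b y).1 z = f.1 (Equiv.swap b y z) := by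
    intro z; simp [transposition]
  set f' := f * transposition b y
  have hby : f'.1 b = y := by rw [hval, Equiv.swap_apply_left, hf.fixed y hy]
  have hyb : f'.1 y = f.1 b := by rw [hval, Equiv.swap_apply_right]
  have hself : ∀ z, f'.1.SameCycle z (f'.1 z) := fun z =>
    Equiv.Perm.sameCycle_apply_right.2 (Equiv.Perm.SameCycle.refl _ _)
  have hB : ∀ z, f.1 z ∈ B ↔ z ∈ B := by
    intro z
    constructor
    · intro h
      by_contra hz
      rw [hf.fixed z hz] at h
      exact hz h
    · intro h
      by_contra hz
      have := f.1.injective (hf.fixed _ hz)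
      rw [this] at hz
      exact hz h
  have hstep : ∀ z ∈ B, f'.1.SameCycle z (f.1 z) := by
    intro z hz
    rcases eq_or_ne z b with rfl | hzb
    · have h1 := hself z
      rw [hby] at h1
      have h2 := hself y
      rw [hyb] at h2
      exact h1.trans h2
    · have h1 := hself z
      rwa [hval, Equiv.swap_apply_of_ne_of_ne hzb (fun h : z = y => hy (h ▸ hz))] at h1
  -- `SameCycle` supplies integer exponents, so the old cycle is followed in both directions.
  have hzpow : ∀ i : ℤ, (f.1 ^ i) x ∈ B ∧ f'.1.SameCycle x ((f.1 ^ i) x) := by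
    intro i
    induction i with
    | zero => exact ⟨hf.mem, Equiv.Perm.SameCycle.refl _ _⟩
    | succ i ih =>
      rw [add_comm, zpow_one_add, Equiv.Perm.mul_apply, hB]
      exact ⟨ih.1, ih.2.trans (hstep _ ih.1)⟩
    | pred i ih =>
      have h1 : f.1 ((f.1 ^ (-(i : ℤ) - 1)) x) = (f.1 ^ (-(i : ℤ))) x := by
        rw [← Equiv.Perm.mul_apply, ← zpow_one_add, add_sub_cancel]
      rw [← h1] at ih
      have h2 := (hB _).1 ih.1
      exact ⟨h2, ih.2.trans (hstep _ h2).symm⟩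
  have hsame : ∀ z ∈ B, f'.1.SameCycle x z := by
    intro z hz
    obtain ⟨i, rfl⟩ := hf.sameCycle z hz
    exact (hzpow i).2
  refine ⟨Finset.mem_insert_of_mem hf.mem, fun z hz => ?_, fun z hz => ?_⟩
  · rw [Finset.mem_insert, not_or] at hz
    rw [hval, Equiv.swap_apply_of_ne_of_ne (fun h : z = b => hz.2 (h ▸ hb)) hz.1, hf.fixed z hz.2]
  · rcases Finset.mem_insert.1 hz with rfl | hz
    · have := hself b
      rw [hby] at this
      exact (hsame b hb).trans this
    · exact hsame z hz

end Blocks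

/-! ### Short words for all cycle types, and generation -/

section Words

variable {H X : Type*} [Group H]

/-- `g` is the product of a word of length `n` over `S ∪ S⁻¹`. -/
def HasWord {G : Type*} [Group G] (S : Set G) (g : G) (n : ℕ) : Prop :=
  ∃ l : List G, l.length = n ∧ (∀ s ∈ l, s ∈ S ∨ s⁻¹ ∈ S) ∧ l.prod = g

theorem HasWord.one {G : Type*} [Group G] (S : Set G) : HasWord S 1 0 :=
  ⟨[], rfl, by simp, rfl⟩

theorem HasWord.of_mem {G : Type*} [Group G] {S : Set G} {g : G} (h : g ∈ S) : HasWord S g 1 :=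
  ⟨[g], rfl, by simp [h], by simp⟩

theorem HasWord.mul {G : Type*} [Group G] {S : Set G} {g h : G} {m n : ℕ} (hg : HasWord S g m)
    (hh : HasWord S h n) : HasWord S (g * h) (m + n) := by
  obtain ⟨l, rfl, hl, rfl⟩ := hg
  obtain ⟨k, rfl, hk, rfl⟩ := hh
  refine ⟨l ++ k, List.length_append, fun s hs => ?_, List.prod_append⟩
  rcases List.mem_append.1 hs with hs | hs
  · exact hl s hs
  · exact hk s hs

theorem HasWord.inv {G : Type*} [Group G] {S : Set G} {g : G} {n : ℕ} (hg : HasWord S g n) :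
    HasWord S g⁻¹ n := by
  obtain ⟨l, rfl, hl, rfl⟩ := hg
  refine ⟨(l.map (·⁻¹)).reverse, by simp, fun s hs => ?_, (List.prod_inv_reverse l).symm⟩
  simp only [List.mem_reverse, List.mem_map] at hs
  obtain ⟨t, ht, rfl⟩ := hs
  rw [inv_inv]
  exact (hl t ht).symm

theorem exists_hasWord {G : Type*} [Group G] {S : Set G} (hS : Subgroup.closure S = ⊤) (g : G) :
    ∃ n, HasWord S g n := by
  have hg : g ∈ Subgroup.closure S := hS ▸ Subgroup.mem_top g
  induction hg using Subgroup.closure_induction with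
  | mem x hx => exact ⟨1, .of_mem hx⟩
  | one => exact ⟨0, .one S⟩
  | mul x y _ _ hx hy =>
    obtain ⟨m, hm⟩ := hx
    obtain ⟨n, hn⟩ := hy
    exact ⟨_, hm.mul hn⟩
  | inv x _ hx =>
    obtain ⟨m, hm⟩ := hx
    exact ⟨m, hm.inv⟩

theorem transposition_comm (x y : X) : transposition x y = transposition y x := by
  apply Subtype.ext
  simp [transposition, Equiv.swap_comm]

theorem transposition_mem_of_adj {SX : Set (FinitarySym X)} {x y : X}
    (h : (transpositionGraph SX).Adj x y) : transposition x y ∈ SX := by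
  rcases (SimpleGraph.fromRel_adj _ _ _).1 h with ⟨-, h | h⟩
  · exact h
  · rwa [transposition_comm]

/-- Inside a connected subgraph of the transposition graph one finds a cycle through `x` on any
number of vertices, as a product of transpositions. -/
theorem exists_isCycleAt {SX : Set (FinitarySym X)} {T : (transpositionGraph SX).Subgraph}
    (hT : T.coe.Connected) {x : X} (hx : x ∈ T.verts) (n : ℕ) (hn : n + 1 ≤ T.verts.encard) :
    ∃ (f : FinitarySym X) (B : Finset X), IsCycleAt f B x ∧ (B : Set X) ⊆ T.verts ∧
      B.card = n + 1 ∧ HasWord SX f n := by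
  classical
  induction n with
  | zero => exact ⟨1, {x}, isCycleAt_one x, by simpa using hx, by simp, .one SX⟩
  | succ n ih =>
    obtain ⟨f, B, hf, hB, hc, hw⟩ := ih (le_trans (by push_cast; gcongr; exact le_self_add) hn)
    obtain ⟨z, hzT, hzB⟩ : ∃ z ∈ T.verts, z ∉ B := by
      by_contra! h
      have h1 := Set.encard_le_encard (show T.verts ⊆ (B : Set X) from h)
      rw [Set.encard_coe_eq_coe_finsetCard, hc] at h1
      have h2 := hn.trans h1
      norm_cast at h2
      omega
    obtain ⟨p⟩ := hT.preconnected ⟨x, hx⟩ ⟨z, hzT⟩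
    -- A walk from `x` to a vertex outside `B` crosses the boundary of `B`; the transposition of the
    -- crossing edge enlarges the cycle by one vertex.
    obtain ⟨d, -, hd1, hd2⟩ := p.exists_boundary_dart (Subtype.val ⁻¹' (B : Set X)) hf.mem hzB
    have hadj : (transpositionGraph SX).Adj d.fst d.snd := T.adj_sub d.adj
    refine ⟨_, _, hf.mul_transposition hd1 hd2, ?_, ?_,
      hw.mul (.of_mem (transposition_mem_of_adj hadj))⟩
    · rw [Finset.coe_insert]
      exact Set.insert_subset d.snd.2 hB
    · rw [Finset.card_insert_of_notMem hd2, hc]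

theorem HasWord.map {G K : Type*} [Group G] [Group K] {S : Set G} {T : Set K} (f : G →* K)
    (h : ∀ s ∈ S, f s ∈ T) {g : G} {n : ℕ} (hg : HasWord S g n) : HasWord T (f g) n := by
  obtain ⟨l, rfl, hl, rfl⟩ := hg
  refine ⟨l.map f, by simp, fun s hs => ?_, by rw [map_list_prod]⟩
  obtain ⟨t, ht, rfl⟩ := List.mem_map.1 hs
  rw [← map_inv]
  exact (hl t ht).imp (h t) (h _)

theorem hasWord_list_prod {ι G : Type*} [Group G] {S : Set G} (g : ι → G) (n : ι → ℕ)
    (l : List ι) (h : ∀ i ∈ l, HasWord S (g i) (n i)) :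
    HasWord S (l.map g).prod (l.map n).sum := by
  induction l with
  | nil => exact .one S
  | cons i l ih =>
    rw [List.map_cons, List.prod_cons, List.map_cons, List.sum_cons]
    exact (h i List.mem_cons_self).mul (ih fun j hj => h j (List.mem_cons_of_mem _ hj))

/-- Every multiset of nontrivial cycle types is attained by an element whose word length is at
most the total weight. -/
theorem exists_typeMultiset_eq {S : Set (Wreath H X)} (hS : IsPCwr S)
    (m : Multiset (ℕ × ConjClasses H)) (hm : ∀ p ∈ m, p ≠ trivialType H ∧ 0 < p.1) :
    ∃ w : Wreath H X, typeMultiset w = m ∧ HasWord S w (m.map typeWeight).sum := by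
  classical
  obtain ⟨SH, SX, -, -, rfl, -, hT⟩ := hS
  obtain ⟨L, rfl⟩ := Quot.exists_rep m
  change ∀ p ∈ (L : Multiset (ℕ × ConjClasses H)), _ at hm
  have hm' : ∀ i : Fin L.length, L.get i ≠ trivialType H ∧ 0 < (L.get i).1 :=
    fun i => hm _ (by simp)
  obtain ⟨T, hT1, hT2, hT3, hT4⟩ := hT L.length (fun i => (L.get i).1) fun i => (hm' i).2
  choose x hxT hxS using hT4
  have hcyc : ∀ i, ∃ (f : FinitarySym X) (B : Finset X), IsCycleAt f B (x i) ∧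
      (B : Set X) ⊆ (T i).verts ∧ B.card = (L.get i).1 ∧ HasWord SX f ((L.get i).1 - 1) := by
    intro i
    have h1 : (L.get i).1 - 1 + 1 = (L.get i).1 := Nat.sub_add_cancel (hm' i).2
    obtain ⟨f, B, h⟩ := exists_isCycleAt (hT1 i).connected (hxT i) ((L.get i).1 - 1) (by
      rw [hT3]; norm_cast; rw [h1])
    rw [h1] at h
    exact ⟨f, B, h⟩
  choose f B hf hBT hBc hfw using hcyc
  have ha : ∀ c : ConjClasses H, ∃ a : H, ConjClasses.mk a = c := ConjClasses.exists_rep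
  choose a ha using ha
  let w : Fin L.length → Wreath H X := fun i => block (x i) (a (L.get i).2) (f i)
  have hBtype : ∀ i, ((B i).card, ConjClasses.mk (a (L.get i).2)) = L.get i :=
    fun i => Prod.ext (hBc i) (ha _)
  have hwtype : ∀ i, typeMultiset (w i) = {L.get i} := by
    intro i
    rw [typeMultiset_block (hf i) (by rw [hBtype]; exact (hm' i).1), hBtype]
  have hwword : ∀ i, HasWord (SemidirectProduct.inl '' SH ∪ SemidirectProduct.inr '' SX)
      (w i) (typeWeight (L.get i)) := by
    intro i
    have h1 : HasWord (SemidirectProduct.inl '' SH ∪ SemidirectProduct.inr '' SX)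
        (SemidirectProduct.inr (f i) : Wreath H X) ((L.get i).1 - 1) :=
      (hfw i).map (SemidirectProduct.inr : FinitarySym X →* Wreath H X)
        fun s hs => Or.inr ⟨s, hs, rfl⟩
    rw [typeWeight]
    split_ifs with h
    -- The class of 1 contains only 1, so the chosen representative is 1 and the letter at `x i`
    -- drops out. This is the saved unit in `typeWeight`.
    · have h2 : a (L.get i).2 = 1 := by
        rw [← isConj_one_right, ← ConjClasses.mk_eq_mk_iff_isConj, ha, h]
      have h3 : single (x i) (1 : H) = 1 := by
        apply Subtype.ext; simp [single]
      simp only [w, block, h2, h3, map_one, one_mul]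
      exact h1
    · have h2 : a (L.get i).2 ≠ 1 := fun h2 => h (by rw [← ha (L.get i).2, h2])
      have h3 := (HasWord.of_mem (S := SemidirectProduct.inl '' SH ∪ SemidirectProduct.inr '' SX)
        (Or.inl ⟨_, hxS i _ h2, rfl⟩)).mul h1
      rwa [Nat.add_sub_cancel' (hm' i).2] at h3
  refine ⟨((List.finRange L.length).map w).prod, ?_, ?_⟩
  · rw [(typeMultiset_list_prod _ _).1, List.map_map]
    · have h1 : typeMultiset ∘ w = (fun p => ({p} : Multiset (ℕ × ConjClasses H))) ∘ L.get :=
        funext hwtype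
      rw [h1, ← List.map_map, List.map_get_finRange]
      exact Multiset.sum_map_singleton (L : Multiset (ℕ × ConjClasses H))
    · rw [List.pairwise_map]
      refine (List.nodup_finRange _).imp fun {i j} hij => ?_
      exact ((hT2 i j hij).mono (hBT i) (hBT j)).mono (moved_block_subset (hf i) _)
        (moved_block_subset (hf j) _)
  · have h1 := hasWord_list_prod w (typeWeight ∘ L.get) (List.finRange L.length)
      fun i _ => hwword i
    rw [← List.map_map, List.map_get_finRange] at h1
    exact h1

/-- A partition-complete subset generates the wreath product. -/
theorem closure_eq_top {S : Set (Wreath H X)} (hS : IsPCwr S) : Subgroup.closure S = ⊤ := by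
  classical
  obtain ⟨SH, SX, -, -, hSeq, hconn, hT⟩ := hS
  let K : Subgroup (FinitarySym X) := (Subgroup.closure S).comap SemidirectProduct.inr
  let K' : Subgroup (Equiv.Perm X) := K.map (FinitarySym X).subtype
  have hSX : ∀ s ∈ SX, s ∈ K := fun s hs =>
    Subgroup.subset_closure (hSeq ▸ Or.inr ⟨s, hs, rfl⟩)
  have hswap : ∀ x y, Equiv.swap x y ∈ K' := by
    intro x y
    obtain ⟨p⟩ := hconn.preconnected x y
    induction p with
    | nil => rw [Equiv.swap_self]; exact K'.one_mem
    | cons h _ ih =>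
      refine SubmonoidClass.swap_mem_trans K' ?_ ih
      refine ⟨_, hSX _ (transposition_mem_of_adj h), ?_⟩
      simp [transposition]
  have hinr : ∀ f : FinitarySym X, SemidirectProduct.inr f ∈ Subgroup.closure S := by
    intro f
    have h1 : f.1 ∈ Subgroup.closure {σ : Equiv.Perm X | σ.IsSwap} :=
      mem_closure_isSwap'.2 f.2
    have h2 : Subgroup.closure {σ : Equiv.Perm X | σ.IsSwap} ≤ K' := by
      rw [Subgroup.closure_le]
      rintro _ ⟨x, y, -, rfl⟩
      exact hswap x y
    obtain ⟨g, hg, hgf⟩ := h2 h1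
    exact Subtype.ext (a1 := g) (a2 := f) hgf ▸ hg
  -- The partition of 1 already provides one point carrying all one-point letters; conjugation by
  -- transpositions spreads them over `X`.
  obtain ⟨T, -, -, -, hT4⟩ := hT 1 (fun _ => 1) fun _ => one_pos
  obtain ⟨x, -, hx⟩ := hT4 0
  have hsingle : ∀ (u : X) (a : H), SemidirectProduct.inl (single u a) ∈ Subgroup.closure S := by
    intro u a
    have h1 : (SemidirectProduct.inl (single x a) : Wreath H X) ∈ Subgroup.closure S := by
      rcases eq_or_ne a 1 with rfl | ha
      · have h3 : single x (1 : H) = 1 := by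
          apply Subtype.ext; simp [single]
        rw [h3, map_one]
        exact Subgroup.one_mem _
      · exact Subgroup.subset_closure (hSeq ▸ Or.inl ⟨_, hx a ha, rfl⟩)
    have h2 := Subgroup.mul_mem _ (Subgroup.mul_mem _ (hinr (transposition u x)) h1)
      (Subgroup.inv_mem _ (hinr (transposition u x)))
    convert h2 using 1
    rw [← map_inv, ← SemidirectProduct.inl_aut]
    congr 1
    apply Subtype.ext
    funext z
    have h4 : ((permAction H X (transposition u x)) (single x a)).1 z =
        (single x a).1 (Equiv.swap u x z) := by
      simp [permAction, transposition]
    rw [h4]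
    rcases eq_or_ne z u with rfl | hzu
    · rw [Equiv.swap_apply_left, single_apply_self, single_apply_self]
    · rw [single_apply_of_ne hzu, single_apply_of_ne]
      intro h
      exact hzu ((Equiv.swap u x).injective (h.trans (Equiv.swap_apply_left u x).symm))
  have hinl : ∀ (F : Finset X) (φ : FinSuppFun H X), (∀ z ∉ F, φ.1 z = 1) →
      SemidirectProduct.inl φ ∈ Subgroup.closure S := by
    intro F
    induction F using Finset.induction_on with
    | empty =>
      intro φ hφ
      rw [show φ = 1 from Subtype.ext (funext fun z => hφ z (Finset.notMem_empty z)), map_one]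
      exact Subgroup.one_mem _
    | insert u F _ ih =>
      intro φ hφ
      have h1 := ih ((single u (φ.1 u))⁻¹ * φ) fun z hz => by
        change ((single u (φ.1 u)).1 z)⁻¹ * φ.1 z = 1
        rcases eq_or_ne z u with rfl | hzu
        · rw [single_apply_self, inv_mul_cancel]
        · rw [single_apply_of_ne hzu, hφ z (by simp [hzu, hz]), inv_one, one_mul]
      have h2 := Subgroup.mul_mem _ (hsingle u (φ.1 u)) h1
      rwa [← map_mul, mul_inv_cancel_left] at h2
  rw [eq_top_iff]
  intro w _
  rw [← SemidirectProduct.inl_left_mul_inr_right w]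
  have hfin : (Function.mulSupport w.left.1).Finite := w.left.2
  refine Subgroup.mul_mem _ (hinl hfin.toFinset _ fun z hz => ?_) (hinr _)
  rwa [Set.Finite.mem_toFinset, Function.notMem_mulSupport] at hz

end Words

/-! ### Conjugacy length and the parametrization of classes -/

section ConjLength

variable {H X : Type*} [Group H]

theorem IsPCwr.subset_letters {S : Set (Wreath H X)} (hS : IsPCwr S) : S ⊆ letters H X := by
  obtain ⟨SH, SX, hH, hX, rfl, -⟩ := hS
  exact Set.union_subset_union (Set.image_mono hH) (Set.image_mono hX)

theorem sum_typeWeight_le_of_hasWord {S : Set (Wreath H X)} (hS : S ⊆ letters H X)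
    {w : Wreath H X} {n : ℕ} (h : HasWord S w n) :
    ((typeMultiset w).map typeWeight).sum ≤ n := by
  obtain ⟨l, rfl, hl, rfl⟩ := h
  exact sum_typeWeight_le_length l fun s hs => (hl s hs).imp (@hS _) (@hS _)

/-- The conjugacy length is the total weight of the cycle types. -/
theorem conjLength_mk {S : Set (Wreath H X)} (hS : IsPCwr S) (w : Wreath H X) :
    conjLength S (ConjClasses.mk w) = ((typeMultiset w).map typeWeight).sum := by
  -- Generation is needed here: the infimum of an empty set of lengths would be 0 and would break
  -- the lower bound.
  have hword : ∀ v : Wreath H X, HasWord S v (wordLength S v) := fun v =>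
    Nat.sInf_mem (s := {n | HasWord S v n}) (exists_hasWord (closure_eq_top hS) v)
  apply le_antisymm
  · obtain ⟨v, hv, hvw⟩ := exists_typeMultiset_eq hS (typeMultiset w)
      fun p hp => ne_trivialType_of_mem hp
    have hmem : v ∈ (ConjClasses.mk w).carrier := by
      rw [ConjClasses.mem_carrier_iff_mk_eq, ConjClasses.mk_eq_mk_iff_isConj]
      exact isConj_of_typeMultiset_eq hv
    exact (Nat.sInf_le (Set.mem_image_of_mem (wordLength S) hmem)).trans
      (Nat.sInf_le (s := {n | HasWord S v n}) hvw)
  · refine le_csInf ⟨_, w, ConjClasses.mem_carrier_mk, rfl⟩ ?_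
    rintro _ ⟨v, hv, rfl⟩
    rw [ConjClasses.mem_carrier_iff_mk_eq, ConjClasses.mk_eq_mk_iff_isConj, isConj_comm] at hv
    obtain ⟨u, rfl⟩ := isConj_iff.1 hv
    rw [← typeMultiset_conj u w]
    exact sum_typeWeight_le_of_hasWord hS.subset_letters (hword _)

open Classical in
/-- The nontrivial cycle type of weight `j.1 + 1` with conjugacy class `j.2`. -/
def typeOfWeight (j : ℕ × ConjClasses H) : ℕ × ConjClasses H :=
  (if j.2 = ConjClasses.mk 1 then j.1 + 2 else j.1 + 1, j.2)

theorem typeWeight_typeOfWeight (j : ℕ × ConjClasses H) :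
    typeWeight (typeOfWeight j) = j.1 + 1 := by
  by_cases h : j.2 = ConjClasses.mk 1 <;> simp [typeWeight, typeOfWeight, h]

theorem typeOfWeight_injective :
    Function.Injective (typeOfWeight : ℕ × ConjClasses H → ℕ × ConjClasses H) := by
  rintro ⟨m, c⟩ ⟨n, d⟩ h
  have h2 : c = d := congrArg Prod.snd h
  subst h2
  have h1 := congrArg Prod.fst h
  simp only [typeOfWeight] at h1
  split_ifs at h1 <;> simpa using h1

theorem typeOfWeight_ne (j : ℕ × ConjClasses H) :
    typeOfWeight j ≠ trivialType H ∧ 0 < (typeOfWeight j).1 := by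
  simp only [typeOfWeight, trivialType, ne_eq, Prod.mk.injEq]
  split_ifs with h
  · exact ⟨fun h' => by omega, by omega⟩
  · exact ⟨fun h' => h h'.2, by omega⟩

theorem exists_typeOfWeight_eq {p : ℕ × ConjClasses H} (hp : p ≠ trivialType H ∧ 0 < p.1) :
    ∃ j, typeOfWeight j = p := by
  obtain ⟨n, c⟩ := p
  by_cases hc : c = ConjClasses.mk 1
  · refine ⟨(n - 2, c), ?_⟩
    -- Excluding the trivial type leaves length at least 2 when the cycle product is trivial, hence
    -- the shift by 2.
    have hn : n ≠ 1 := fun hn => hp.1 (by rw [hn, hc]; rfl)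
    have hpos : 0 < n := hp.2
    rw [typeOfWeight, if_pos hc, Nat.sub_add_cancel (show 2 ≤ n by omega)]
  · exact ⟨(n - 1, c), by rw [typeOfWeight, if_neg hc, Nat.sub_add_cancel hp.2]⟩

/-- Conjugacy classes of the wreath product correspond to finite multisets in `ℕ × Conj(H)`. -/
theorem exists_conjClasses_equiv {S : Set (Wreath H X)} (hS : IsPCwr S) :
    ∃ e : Multiset (ℕ × ConjClasses H) ≃ ConjClasses (Wreath H X),
      ∀ m, conjLength S (e m) = (m.map fun j => j.1 + 1).sum := by
  have hex : ∀ m : Multiset (ℕ × ConjClasses H), ∃ w : Wreath H X,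
      typeMultiset w = m.map typeOfWeight := by
    intro m
    obtain ⟨w, hw, -⟩ := exists_typeMultiset_eq hS (m.map typeOfWeight) (by
      intro p hp
      obtain ⟨j, -, rfl⟩ := Multiset.mem_map.1 hp
      exact typeOfWeight_ne j)
    exact ⟨w, hw⟩
  choose w hw using hex
  have hbij : Function.Bijective fun m => ConjClasses.mk (w m) := by
    constructor
    · intro m m' h
      obtain ⟨u, hu⟩ := isConj_iff.1 (ConjClasses.mk_eq_mk_iff_isConj.1 h)
      apply Multiset.map_injective typeOfWeight_injective
      rw [← hw, ← hw, ← hu, typeMultiset_conj]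
    · intro c
      obtain ⟨v, rfl⟩ := ConjClasses.exists_rep c
      have hlift : ∀ m : Multiset (ℕ × ConjClasses H), (∀ p ∈ m, ∃ j, typeOfWeight j = p) →
          ∃ m' : Multiset (ℕ × ConjClasses H), m'.map typeOfWeight = m := by
        intro m
        induction m using Multiset.induction with
        | empty => exact fun _ => ⟨0, rfl⟩
        | cons p m ih =>
          intro h
          obtain ⟨m', rfl⟩ := ih fun q hq => h q (Multiset.mem_cons_of_mem hq)
          obtain ⟨j, rfl⟩ := h p (Multiset.mem_cons_self p _)
          exact ⟨j ::ₘ m', Multiset.map_cons _ _ _⟩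
      obtain ⟨m, hm⟩ := hlift (typeMultiset v) fun p hp =>
        exists_typeOfWeight_eq (ne_trivialType_of_mem hp)
      refine ⟨m, ?_⟩
      change ConjClasses.mk (w m) = ConjClasses.mk v
      rw [ConjClasses.mk_eq_mk_iff_isConj]
      exact isConj_of_typeMultiset_eq ((hw m).trans hm)
  refine ⟨Equiv.ofBijective _ hbij, fun m => ?_⟩
  rw [Equiv.ofBijective_apply, conjLength_mk hS, hw, Multiset.map_map]
  congr 1
  exact Multiset.map_congr rfl fun j _ => typeWeight_typeOfWeight j

end ConjLength

/-! ### The Euler product -/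

section Counting

open PowerSeries

theorem coeff_inv_one_sub_X_pow {n : ℕ} (hn : 0 < n) (k : ℕ) :
    coeff k ((1 - (X : PowerSeries ℚ) ^ n)⁻¹) = if n ∣ k then 1 else 0 := by
  have h : (mk fun k => if n ∣ k then (1 : ℚ) else 0) = (1 - (X : PowerSeries ℚ) ^ n)⁻¹ := by
    rw [PowerSeries.eq_inv_iff_mul_eq_one (by simp [hn.ne'])]
    ext k
    rw [mul_sub, mul_one, map_sub, coeff_mul_X_pow', coeff_mk, coeff_one]
    rcases lt_or_ge k n with hk | hk
    · rw [if_neg (not_le.2 hk), sub_zero]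
      congr 1
      exact propext ⟨fun h => Nat.eq_zero_of_dvd_of_lt h hk, fun h => h ▸ dvd_zero n⟩
    · rw [if_pos hk, coeff_mk, if_neg (by omega : k ≠ 0)]
      rw [sub_eq_zero]
      congr 1
      exact propext (Nat.dvd_sub_iff_left hk dvd_rfl).symm
  rw [← h, coeff_mk]

theorem pow_inv_eq (f : PowerSeries ℚ) (n : ℕ) : (f ^ n)⁻¹ = f⁻¹ ^ n := by
  induction n with
  | zero => simp
  | succ n ih => rw [pow_succ, PowerSeries.mul_inv_rev, ih, pow_succ']

/-- Coefficients of a finite product of geometric series count multisets by weight. -/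
theorem coeff_prod_inv_one_sub_X_pow {ι : Type*} (A : Finset ι) (wt : ι → ℕ)
    (hwt : ∀ i, 0 < wt i) (d : ℕ) :
    ∃ k : ℕ, {m : Multiset ι | (∀ i ∈ m, i ∈ A) ∧ (m.map wt).sum = d}.encard = k ∧
      coeff d (∏ i ∈ A, (1 - (X : PowerSeries ℚ) ^ wt i)⁻¹) = (k : ℚ) := by
  classical
  let F : Finset (ι →₀ ℕ) := (A.finsuppAntidiag d).filter fun l => ∀ i ∈ A, wt i ∣ l i
  -- Recording multiplicity times weight turns a multiset of total weight `d` into a way of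
  -- splitting the exponent `d` among the factors, as in `coeff_prod`.
  let φ : Multiset ι → (ι →₀ ℕ) := fun m =>
    Finsupp.onFinset m.toFinset (fun i => m.count i * wt i) fun i hi => by
      rw [Multiset.mem_toFinset]
      by_contra h
      exact hi (by rw [Multiset.count_eq_zero_of_notMem h, zero_mul])
  have hφ : ∀ m i, φ m i = m.count i * wt i := fun m i => rfl
  have hinj : Function.Injective φ := by
    intro m m' h
    ext i
    have := DFunLike.congr_fun h i
    rw [hφ, hφ] at this
    exact Nat.eq_of_mul_eq_mul_right (hwt i) this
  have hsum : ∀ m : Multiset ι, (∀ i ∈ m, i ∈ A) → (m.map wt).sum = ∑ i ∈ A, m.count i * wt i := by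
    intro m hm
    rw [Finset.sum_multiset_map_count]
    refine Finset.sum_subset (fun i hi => hm i (Multiset.mem_toFinset.1 hi)) fun i _ hi => ?_
    rw [Multiset.mem_toFinset] at hi
    rw [Multiset.count_eq_zero_of_notMem hi, zero_smul]
  have himg : φ '' {m : Multiset ι | (∀ i ∈ m, i ∈ A) ∧ (m.map wt).sum = d} = (F : Set _) := by
    ext l
    simp only [Set.mem_image, Set.mem_ofPred_eq, F, Finset.coe_filter, Finset.mem_finsuppAntidiag]
    constructor
    · rintro ⟨m, ⟨hm, hd⟩, rfl⟩
      refine ⟨⟨by rw [← hd, hsum m hm]; rfl, fun i hi => ?_⟩, fun i _ => Dvd.intro_left _ rfl⟩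
      rw [Finsupp.mem_support_iff, hφ] at hi
      exact hm i (Multiset.count_ne_zero.1 (left_ne_zero_of_mul hi))
    · rintro ⟨⟨hd, hsupp⟩, hdvd⟩
      let m : Multiset ι := ∑ i ∈ A, Multiset.replicate (l i / wt i) i
      have hcount : ∀ i, m.count i = if i ∈ A then l i / wt i else 0 := by
        intro i
        simp [m, Multiset.count_sum', Multiset.count_replicate]
      have hmA : ∀ i ∈ m, i ∈ A := by
        intro i hi
        by_contra h
        have := hcount i
        rw [if_neg h] at this
        exact Multiset.count_ne_zero.2 hi this
      have hml : φ m = l := by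
        ext i
        rw [hφ, hcount]
        split_ifs with h
        · exact Nat.div_mul_cancel (hdvd i h)
        · rw [zero_mul, eq_comm]
          by_contra h'
          exact h (hsupp (Finsupp.mem_support_iff.2 h'))
      refine ⟨m, ⟨hmA, ?_⟩, hml⟩
      rw [hsum m hmA, ← hd, ← hml]
      rfl
  refine ⟨F.card, ?_, ?_⟩
  · rw [← hinj.encard_image, himg, Set.encard_coe_eq_coe_finsetCard]
  · rw [coeff_prod, Finset.card_filter, Nat.cast_sum]
    refine Finset.sum_congr rfl fun l _ => ?_
    rw [Finset.prod_congr rfl fun i _ => coeff_inv_one_sub_X_pow (hwt i) (l i),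
      Finset.prod_ite_zero]
    simp

variable {H Y : Type*} [Group H] [Finite H]

/-- Index `n` stands for weight `n + 1`, and no part of a multiset of total weight `d` exceeds `d`,
so the factors beyond `range d` are irrelevant. Allowing any larger `s` gives both convergence of
the product and a single finite product for the recursion. -/
theorem conjGrowth_eq_coeff_prod {S : Set (Wreath H Y)} (hS : IsPCwr S) {d : ℕ} {s : Finset ℕ}
    (hs : Finset.range d ⊆ s) :
    conjGrowth S d ≠ ⊤ ∧ ((conjGrowth S d).toNat : ℚ) =
      coeff d (∏ n ∈ s, ((1 - (X : PowerSeries ℚ) ^ (n + 1)) ^ Nat.card (ConjClasses H))⁻¹) := by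
  classical
  have : Fintype (ConjClasses H) := Fintype.ofFinite _
  obtain ⟨e, he⟩ := exists_conjClasses_equiv hS
  obtain ⟨k, hk, hc⟩ := coeff_prod_inv_one_sub_X_pow (s ×ˢ (Finset.univ : Finset (ConjClasses H)))
    (fun j => j.1 + 1) (fun j => Nat.succ_pos _) d
  have hset : {c : ConjClasses (Wreath H Y) | conjLength S c = d} =
      e '' {m | (∀ j ∈ m, j ∈ s ×ˢ (Finset.univ : Finset (ConjClasses H))) ∧
        (m.map fun j => j.1 + 1).sum = d} := by
    ext c
    obtain ⟨m, rfl⟩ := e.surjective c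
    rw [e.injective.mem_set_image, Set.mem_ofPred_eq, Set.mem_ofPred_eq, he]
    refine ⟨fun h => ⟨fun j hj => ?_, h⟩, fun h => h.2⟩
    have h1 : j.1 + 1 ≤ d := h ▸ Multiset.single_le_sum (fun _ _ => Nat.zero_le _) _
      (Multiset.mem_map_of_mem (fun j : ℕ × ConjClasses H => j.1 + 1) hj)
    exact Finset.mem_product.2 ⟨hs (Finset.mem_range.2 h1), Finset.mem_univ _⟩
  have hcard : conjGrowth S d = k := by
    rw [conjGrowth, hset, e.injective.encard_image, hk]
  refine ⟨by rw [hcard]; exact ENat.natCast_ne_top k, ?_⟩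
  rw [hcard, ENat.toNat_natCast, ← hc, Finset.prod_product]
  congr 1
  refine Finset.prod_congr rfl fun n _ => ?_
  dsimp only
  rw [Finset.prod_const, Finset.card_univ, pow_inv_eq, Nat.card_eq_fintype_card]

theorem hasSum_conjGrowthSeries {S : Set (Wreath H Y)} (hS : IsPCwr S) :
    HasSum (fun c : ConjClasses (Wreath H Y) => (X : PowerSeries ℚ) ^ conjLength S c)
      (conjGrowthSeries S) := by
  classical
  rw [PowerSeries.WithPiTopology.hasSum_iff_hasSum_coeff]
  intro d
  have hfin : {c : ConjClasses (Wreath H Y) | conjLength S c = d}.Finite := by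
    rw [← Set.encard_ne_top_iff]
    exact (conjGrowth_eq_coeff_prod hS (subset_refl (Finset.range d))).1
  have h1 : coeff d (conjGrowthSeries S) =
      ∑ c ∈ hfin.toFinset, coeff d ((X : PowerSeries ℚ) ^ conjLength S c) := by
    rw [Finset.sum_congr rfl (g := fun _ => 1)]
    · rw [conjGrowthSeries, coeff_mk, conjGrowth, hfin.encard_eq_coe_toFinset_card]
      simp
    · intro c hc
      rw [Set.Finite.mem_toFinset, Set.mem_ofPred_eq] at hc
      rw [hc, coeff_X_pow_self]
  rw [h1]
  refine hasSum_sum_of_ne_finset_zero fun c hc => ?_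
  rw [Set.Finite.mem_toFinset, Set.mem_ofPred_eq] at hc
  rw [coeff_X_pow, if_neg (Ne.symm hc)]

theorem hasProd_conjGrowthSeries {S : Set (Wreath H Y)} (hS : IsPCwr S) :
    HasProd (fun n : ℕ => ((1 - (X : PowerSeries ℚ) ^ (n + 1)) ^ Nat.card (ConjClasses H))⁻¹)
      (conjGrowthSeries S) := by
  rw [HasProd, SummationFilter.unconditional_filter,
    PowerSeries.WithPiTopology.tendsto_iff_coeff_tendsto]
  intro d
  refine tendsto_const_nhds.congr' ?_
  filter_upwards [Filter.eventually_ge_atTop (Finset.range d)] with s hs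
  rw [← (conjGrowth_eq_coeff_prod hS hs).2, conjGrowthSeries, coeff_mk]

end Counting

/-! ### The recursion from the logarithmic derivative -/

section Recursion

open PowerSeries

/-- The truncated logarithm `∑_{k=1}^N (-1)^{k-1} A^k / k` of `1 + A`. -/
def truncLog (N : ℕ) (A : PowerSeries ℚ) : PowerSeries ℚ :=
  ∑ k ∈ Finset.range N, C ((-1 : ℚ) ^ k / (k + 1)) * A ^ (k + 1)

/-- The derivative of the truncated logarithm is `A'` times a finite geometric sum in `-A`, which `1
+ A` telescopes. -/
theorem one_add_mul_derivative_truncLog (N : ℕ) (A : PowerSeries ℚ) :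
    (1 + A) * d⁄dX ℚ (truncLog N A) = d⁄dX ℚ A * (1 - (-A) ^ N) := by
  have h1 : d⁄dX ℚ (truncLog N A) = d⁄dX ℚ A * ∑ k ∈ Finset.range N, (-A) ^ k := by
    rw [truncLog, map_sum, Finset.mul_sum]
    refine Finset.sum_congr rfl fun k _ => ?_
    rw [Derivation.leibniz, derivative_C, smul_zero, add_zero, derivative_pow, smul_eq_mul,
      Nat.add_sub_cancel]
    have h2 : C ((-1 : ℚ) ^ k / (k + 1)) * ((k + 1 : ℕ) : PowerSeries ℚ) = (-1) ^ k := by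
      rw [← map_natCast (C (R := ℚ)), ← map_mul, Nat.cast_add, Nat.cast_one,
        div_mul_cancel₀ _ (by positivity)]
      simp
    rw [neg_pow]
    calc _ = (C ((-1 : ℚ) ^ k / (k + 1)) * ((k + 1 : ℕ) : PowerSeries ℚ)) * A ^ k * d⁄dX ℚ A := by
          ring_nf
      _ = _ := by rw [h2]; ring
  rw [h1, mul_left_comm, ← mul_neg_geom_sum (-A) N, sub_neg_eq_add]

theorem coeff_X_mul_derivative (f : PowerSeries ℚ) (n : ℕ) :
    coeff n (X * d⁄dX ℚ f) = n * coeff n f := by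
  cases n with
  | zero => simp
  | succ n => rw [coeff_succ_X_mul, coeff_derivative]; push_cast; ring

/-- If `L` is the logarithmic derivative of `1 + A`, its coefficients are read off from the
truncated logarithm. -/
theorem coeff_truncLog {A L : PowerSeries ℚ} (hA : constantCoeff A = 0)
    (hL : constantCoeff L = 0) (h : X * d⁄dX ℚ (1 + A) = (1 + A) * L) (n : ℕ) :
    n * coeff n (truncLog n A) = coeff n L := by
  have hne : (1 + A) ≠ 0 := by
    intro h0
    have := congrArg constantCoeff h0
    simp [hA] at this
  have h1 : X * d⁄dX ℚ (truncLog n A) = L - L * (-A) ^ n := by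
    apply mul_left_cancel₀ hne
    rw [mul_left_comm, one_add_mul_derivative_truncLog, ← mul_assoc]
    have h2 : d⁄dX ℚ (1 + A) = d⁄dX ℚ A := by rw [map_add, derivative_one, zero_add]
    rw [← h2, h]
    ring
  rw [← coeff_X_mul_derivative, h1, map_sub]
  -- Both `L` and `A` vanish at 0, so truncating the logarithm after `n` terms does not affect the
  -- coefficient of degree `n`.
  have h3 : (X : PowerSeries ℚ) ^ (n + 1) ∣ L * (-A) ^ n := by
    rw [pow_succ']
    exact mul_dvd_mul (X_dvd_iff.2 hL) (pow_dvd_pow_of_dvd (X_dvd_iff.2 (by simp [hA])) n)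
  rw [X_pow_dvd_iff.1 h3 n (Nat.lt_succ_self n), sub_zero]

/-- In a power with exponent at least 2 an additional factor divisible by `X` gains one degree.
Hence only the linear term of the logarithm involves the top coefficient. -/
theorem pow_sub_pow_dvd {A B : PowerSeries ℚ} {n : ℕ} (hA : X ∣ A) (hB : X ∣ B)
    (h : X ^ n ∣ A - B) (k : ℕ) : X ^ (n + 1) ∣ A ^ (k + 2) - B ^ (k + 2) := by
  have h1 : A ^ (k + 2) - B ^ (k + 2) =
      (A ^ (k + 1) - B ^ (k + 1)) * A + (A - B) * B ^ (k + 1) := by ring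
  rw [h1, pow_succ]
  refine dvd_add (mul_dvd_mul (h.trans (sub_dvd_pow_sub_pow A B (k + 1))) hA)
    (mul_dvd_mul h (hB.trans (dvd_pow_self B (Nat.succ_ne_zero k))))

/-- The polynomial with coefficients `g 1, …, g (n - 1)`. -/
def headSeries (g : ℕ → ℚ) (n : ℕ) : PowerSeries ℚ :=
  ∑ i : Fin (n - 1), C (g (i + 1)) * X ^ ((i : ℕ) + 1)

theorem coeff_headSeries (g : ℕ → ℚ) (n m : ℕ) :
    coeff m (headSeries g n) = if 0 < m ∧ m < n then g m else 0 := by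
  rw [headSeries, map_sum]
  simp only [coeff_C_mul, coeff_X_pow, mul_ite, mul_one, mul_zero]
  split_ifs with h
  · rw [Finset.sum_eq_single (⟨m - 1, by omega⟩ : Fin (n - 1))]
    · have h1 : m - 1 + 1 = m := by omega
      simp [h1]
    · intro i _ hi
      rw [if_neg]
      exact fun h' => hi (Fin.ext (by simp; omega))
    · simp
  · refine Finset.sum_eq_zero fun i _ => if_neg fun h' => h ?_
    have := i.2
    omega

theorem coeff_headSeries_pow (g : ℕ → ℚ) (n k : ℕ) :
    coeff n (headSeries g n ^ k) =
      ∑ m ∈ (exponents n).filter (fun m => ∑ i, m i = k),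
        (k.factorial : ℚ) / (∏ i, ((m i).factorial : ℚ)) * ∏ i : Fin (n - 1), g (i + 1) ^ m i := by
  rw [headSeries, Finset.sum_pow_eq_sum_piAntidiag, map_sum]
  have h1 : ∀ m ∈ Finset.piAntidiag (Finset.univ : Finset (Fin (n - 1))) k,
      coeff n ((Nat.multinomial Finset.univ m : PowerSeries ℚ) *
        ∏ i : Fin (n - 1), (C (g (i + 1)) * X ^ ((i : ℕ) + 1)) ^ m i) =
      if ∑ i : Fin (n - 1), ((i : ℕ) + 1) * m i = n then
        (k.factorial : ℚ) / (∏ i, ((m i).factorial : ℚ)) * ∏ i : Fin (n - 1), g (i + 1) ^ m i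
      else 0 := by
    intro m hm
    rw [Finset.mem_piAntidiag] at hm
    have h2 : (Nat.multinomial Finset.univ m : ℚ) =
        (k.factorial : ℚ) / (∏ i, ((m i).factorial : ℚ)) := by
      rw [eq_div_iff (Finset.prod_ne_zero_iff.2 fun i _ => by positivity), mul_comm]
      have := Nat.multinomial_spec Finset.univ m
      rw [hm.1] at this
      exact_mod_cast this
    simp only [mul_pow, Finset.prod_mul_distrib, ← pow_mul, Finset.prod_pow_eq_pow_sum,
      ← map_pow, ← map_prod]
    rw [← map_natCast (C (R := ℚ)), ← mul_assoc, ← map_mul, coeff_C_mul, coeff_X_pow, h2]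
    simp only [eq_comm, mul_ite, mul_one, mul_zero]
  rw [Finset.sum_congr rfl h1, ← Finset.sum_filter]
  refine Finset.sum_congr (Finset.ext fun m => ?_) fun _ _ => rfl
  simp only [exponents, Finset.mem_filter, Finset.mem_piAntidiag, Fintype.mem_piFinset,
    Finset.mem_range]
  constructor
  · rintro ⟨⟨h2, -⟩, h3⟩
    refine ⟨⟨fun i => ?_, h3⟩, h2⟩
    have h4 := Finset.single_le_sum (f := fun i : Fin (n - 1) => ((i : ℕ) + 1) * m i)
      (fun i _ => Nat.zero_le _) (Finset.mem_univ i)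
    have h5 : m i ≤ ((i : ℕ) + 1) * m i := Nat.le_mul_of_pos_left _ (Nat.succ_pos _)
    simp only [h3] at h4
    omega
  · rintro ⟨⟨-, h3⟩, h2⟩
    exact ⟨⟨h2, fun i _ => Finset.mem_univ i⟩, h3⟩

/-- Grouping the exponent tuples by their sum `k + 1` matches the powers in the logarithm; `(k + 1)!
/ (k + 1) = k!` gives the factorial in `Fhat`, and the sign is off by one, whence the minus. -/
theorem coeff_truncLog_headSeries (g : ℕ → ℚ) {n : ℕ} (hn : 1 ≤ n) :
    coeff n (truncLog n (headSeries g n)) =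
      -MvPolynomial.eval (fun i : Fin (n - 1) => g ((i : ℕ) + 1)) (Fhat n) := by
  have hmaps : ∀ m ∈ exponents n, ∑ i, m i - 1 ∈ Finset.range n ∧ 1 ≤ ∑ i, m i := by
    intro m hm
    have h1 : ∑ i : Fin (n - 1), ((i : ℕ) + 1) * m i = n := (Finset.mem_filter.1 hm).2
    have h2 : ∑ i, m i ≤ ∑ i : Fin (n - 1), ((i : ℕ) + 1) * m i :=
      Finset.sum_le_sum fun i _ => Nat.le_mul_of_pos_left _ (Nat.succ_pos _)
    have h3 : ∑ i, m i ≠ 0 := by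
      intro h0
      rw [Finset.sum_eq_zero_iff] at h0
      rw [Finset.sum_eq_zero fun i hi => by rw [h0 i hi, mul_zero]] at h1
      omega
    exact ⟨Finset.mem_range.2 (by omega), by omega⟩
  rw [truncLog, map_sum, Fhat, map_sum, ← Finset.sum_neg_distrib,
    ← Finset.sum_fiberwise_of_maps_to fun m hm => (hmaps m hm).1]
  refine Finset.sum_congr rfl fun k _ => ?_
  rw [coeff_C_mul, coeff_headSeries_pow, Finset.mul_sum]
  have hfil : (exponents n).filter (fun m => ∑ i, m i = k + 1) =
      (exponents n).filter fun m => ∑ i, m i - 1 = k := by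
    refine Finset.filter_congr fun m hm => ?_
    have := (hmaps m hm).2
    omega
  rw [← hfil]
  refine Finset.sum_congr rfl fun m hm => ?_
  rw [(Finset.mem_filter.1 hm).2, Nat.add_sub_cancel]
  simp only [map_mul, map_prod, map_pow, MvPolynomial.eval_C, MvPolynomial.eval_X]
  rw [Nat.factorial_succ, pow_succ]
  have hk : (k : ℚ) + 1 ≠ 0 := by positivity
  push_cast
  field_simp

/-- The recursion for the coefficients of a series with given logarithmic derivative. -/
theorem coeff_eq_eval_Fhat_add {P L : PowerSeries ℚ} (hP : constantCoeff P = 1)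
    (hL : constantCoeff L = 0) (h : X * d⁄dX ℚ P = P * L) {n : ℕ} (hn : 1 ≤ n) :
    coeff n P = MvPolynomial.eval (fun i : Fin (n - 1) => coeff ((i : ℕ) + 1) P) (Fhat n) +
      coeff n L / n := by
  set A := P - 1 with hA
  set B := headSeries (fun m => coeff m P) n
  have hPA : P = 1 + A := by rw [hA]; ring
  have hA0 : constantCoeff A = 0 := by rw [hA, map_sub, hP, map_one, sub_self]
  have hXA : X ∣ A := X_dvd_iff.2 hA0
  have hXB : X ∣ B := by
    rw [X_dvd_iff, ← coeff_zero_eq_constantCoeff_apply, coeff_headSeries, if_neg (by omega)]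
  have hAB : X ^ n ∣ A - B := by
    rw [X_pow_dvd_iff]
    intro m hm
    rw [map_sub, coeff_headSeries, hA, map_sub, coeff_one]
    rcases Nat.eq_zero_or_pos m with rfl | hpos
    · simp [hP]
    · rw [if_neg hpos.ne', if_pos ⟨hpos, hm⟩]; ring
  have h1 := coeff_truncLog hA0 hL (hPA ▸ h) n
  -- The head `B` has no term of degree `n`, so the linear term contributes `coeff n P`; all higher
  -- powers of `A` and `B` agree through degree `n`.
  have h2 : coeff n (truncLog n A) = coeff n P + coeff n (truncLog n B) := by
    rw [← sub_eq_iff_eq_add, ← map_sub, truncLog, truncLog, ← Finset.sum_sub_distrib, map_sum,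
      Finset.sum_eq_single 0]
    · simp only [zero_add, pow_zero, pow_one, CharP.cast_eq_zero, div_one, map_one, one_mul]
      rw [map_sub, coeff_headSeries, if_neg (by omega), hA, map_sub, coeff_one, if_neg (by omega)]
      ring
    · intro k _ hk
      obtain ⟨k, rfl⟩ := Nat.exists_eq_succ_of_ne_zero hk
      rw [← mul_sub, coeff_C_mul,
        X_pow_dvd_iff.1 (pow_sub_pow_dvd hXA hXB hAB k) n (Nat.lt_succ_self n), mul_zero]
    · intro h0
      exact absurd (Finset.mem_range.2 hn) h0
  rw [h2, coeff_truncLog_headSeries _ hn] at h1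
  have hn0 : (n : ℚ) ≠ 0 := by positivity
  rw [← h1]
  field_simp
  ring

theorem X_mul_derivative_prod {ι : Type*} (s : Finset ι) (P L : ι → PowerSeries ℚ)
    (h : ∀ i ∈ s, X * d⁄dX ℚ (P i) = P i * L i) :
    X * d⁄dX ℚ (∏ i ∈ s, P i) = (∏ i ∈ s, P i) * ∑ i ∈ s, L i := by
  classical
  induction s using Finset.induction_on with
  | empty => simp
  | insert i s hi ih =>
    rw [Finset.prod_insert hi, Finset.sum_insert hi, Derivation.leibniz, smul_eq_mul, smul_eq_mul]
    have h1 := h i (Finset.mem_insert_self i s)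
    have h2 := ih fun j hj => h j (Finset.mem_insert_of_mem hj)
    linear_combination (P i) * h2 + (∏ j ∈ s, P j) * h1

theorem X_mul_derivative_inv_one_sub_X_pow (M n : ℕ) :
    X * d⁄dX ℚ (((1 - (X : PowerSeries ℚ) ^ (n + 1)) ^ M)⁻¹) =
      ((1 - (X : PowerSeries ℚ) ^ (n + 1)) ^ M)⁻¹ *
        (C (M * (n + 1) : ℚ) * (X ^ (n + 1) * (1 - (X : PowerSeries ℚ) ^ (n + 1))⁻¹)) := by
  have h1 : X * d⁄dX ℚ ((1 - (X : PowerSeries ℚ) ^ (n + 1))⁻¹) =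
      (1 - (X : PowerSeries ℚ) ^ (n + 1))⁻¹ *
        (C (n + 1 : ℚ) * (X ^ (n + 1) * (1 - (X : PowerSeries ℚ) ^ (n + 1))⁻¹)) := by
    rw [derivative_inv', map_sub, derivative_one, derivative_pow, derivative_X,
      Nat.add_sub_cancel]
    have : (C (n + 1 : ℚ)) = ((n + 1 : ℕ) : PowerSeries ℚ) := by
      rw [← map_natCast (C (R := ℚ))]; push_cast; rfl
    rw [this]
    ring
  have h2 := X_mul_derivative_prod (Finset.range M) _ _ fun _ _ => h1
  rw [Finset.prod_const, Finset.sum_const, Finset.card_range, ← pow_inv_eq] at h2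
  rw [h2, nsmul_eq_mul, map_mul, map_natCast]
  ring

/-- A Lambert series: the summand of index `i` contributes `M * (i + 1)` in degree `n` exactly when
`i + 1` divides `n`. -/
theorem coeff_sum_divisors (M n : ℕ) :
    coeff n (∑ i ∈ Finset.range n, C (M * (i + 1) : ℚ) *
      (X ^ (i + 1) * (1 - (X : PowerSeries ℚ) ^ (i + 1))⁻¹)) =
      M * (ArithmeticFunction.sigma 1 n : ℚ) := by
  rw [map_sum, ArithmeticFunction.sigma_one_apply, Nat.cast_sum, Finset.mul_sum,
    Nat.divisors, Finset.sum_filter, Finset.sum_Ico_eq_sum_range, Nat.add_sub_cancel]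
  refine Finset.sum_congr rfl fun i hi => ?_
  rw [Finset.mem_range] at hi
  rw [coeff_C_mul, coeff_X_pow_mul', if_pos (by omega : i + 1 ≤ n),
    coeff_inv_one_sub_X_pow (Nat.succ_pos i)]
  have h1 : i + 1 ∣ n - (i + 1) ↔ 1 + i ∣ n := by
    rw [add_comm 1 i]; exact Nat.dvd_sub_iff_left (by omega) dvd_rfl
  simp only [h1]
  split_ifs <;> push_cast <;> ring

variable {H Y : Type*} [Group H] [Finite H]

theorem conjGrowth_recursion {S : Set (Wreath H Y)} (hS : IsPCwr S) {n : ℕ} (hn : 1 ≤ n) :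
    ((conjGrowth S n).toNat : ℚ) =
      MvPolynomial.eval (fun i : Fin (n - 1) => ((conjGrowth S ((i : ℕ) + 1)).toNat : ℚ))
        (Fhat n) + (Nat.card (ConjClasses H) : ℚ) / n * (ArithmeticFunction.sigma 1 n : ℚ) := by
  set M := Nat.card (ConjClasses H)
  -- The recursion only involves degrees up to `n`, where this finite product agrees with the growth
  -- series; differentiation stays within finite products.
  let P : PowerSeries ℚ := ∏ i ∈ Finset.range n, ((1 - (X : PowerSeries ℚ) ^ (i + 1)) ^ M)⁻¹
  have hP : ∀ m ≤ n, ((conjGrowth S m).toNat : ℚ) = coeff m P := fun m hm =>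
    (conjGrowth_eq_coeff_prod hS (Finset.range_mono hm)).2
  have hP0 : constantCoeff P = 1 := by
    rw [map_prod]
    exact Finset.prod_eq_one fun i _ => by simp
  have hlog := X_mul_derivative_prod (Finset.range n) _ _ fun i _ =>
    X_mul_derivative_inv_one_sub_X_pow M i
  have hrec := coeff_eq_eval_Fhat_add hP0
    (by rw [map_sum]; exact Finset.sum_eq_zero fun i _ => by simp) hlog hn
  rw [coeff_sum_divisors M n] at hrec
  rw [hP n le_rfl, hrec]
  congr 2
  · congr 2
    funext i
    have := i.2
    exact (hP _ (by omega)).symm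
  · ring

end Recursion

end WreathGrowth

end

theorem mainTheorem3 {H X : Type*} [Group H] [Finite H] [Infinite X]
    (S : Set (WreathGrowth.Wreath H X)) (hS : WreathGrowth.IsPCwr S) :
    Subgroup.closure S = ⊤ ∧
    (∀ n : ℕ, WreathGrowth.conjGrowth S n ≠ ⊤) ∧
    HasSum (fun c : ConjClasses (WreathGrowth.Wreath H X) =>
        (PowerSeries.X : PowerSeries ℚ) ^ WreathGrowth.conjLength S c)
      (WreathGrowth.conjGrowthSeries S) ∧
    HasProd (fun n : ℕ =>
        ((1 - (PowerSeries.X : PowerSeries ℚ) ^ (n + 1)) ^ Nat.card (ConjClasses H))⁻¹)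
      (WreathGrowth.conjGrowthSeries S) ∧
    ∀ n : ℕ, 1 ≤ n →
      ((WreathGrowth.conjGrowth S n).toNat : ℚ) =
        MvPolynomial.eval
            (fun i : Fin (n - 1) => ((WreathGrowth.conjGrowth S ((i : ℕ) + 1)).toNat : ℚ))
            (WreathGrowth.Fhat n) +
          (Nat.card (ConjClasses H) : ℚ) / n * (ArithmeticFunction.sigma 1 n : ℚ) :=
  ⟨WreathGrowth.closure_eq_top hS,
    fun n => (WreathGrowth.conjGrowth_eq_coeff_prod hS (subset_refl (Finset.range n))).1,
    WreathGrowth.hasSum_conjGrowthSeries hS, WreathGrowth.hasProd_conjGrowthSeries hS,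
    fun _ hn => WreathGrowth.conjGrowth_recursion hS hn⟩
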